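/- Let $X$ be a smooth manifold (Hausdorff, second countable, without boundary) of finite real dimension at least $4$, let $J$ be a smooth almost complex structure on $X$, i.e. a smooth endomorphism of $TX$ with $J^2=-\mathrm{id}$, and let $U\subset X$ be a nonempty open set. Then there is a smooth almost complex structure $J'$ on $X$ such that 1. $J'$ is deformation equivalent to $J$, i.e. there is a smooth family $(J_t)_{t\in[0,1]}$ of almost complex structures on $X$ with $J_0=J$ and $J_1=J'$; 2. $J'=J$ on $X\setminus U$; 3. $J'$ admits no taming symplectic form, i.e. there is no closed nondegenerate smooth $2$-form $\omega$ on $X$ with $\omega(v,J'v)>0$ for every nonzero tangent vector $v$. Moreover, $J'$ can be chosen so that, in addition, $U$ contains a $J'$-holomorphic embedded torus that is null-homologous in $X$: there are an almost complex structure $j$ on the $2$-torus $T^2=S^1\times S^1$ and a smooth embedding $f\colon T^2\to X$ with $f(T^2)\subset U$, $\mathrm{d}f\circ j=J'\circ \mathrm{d}f$, and $f_*=0\colon H_2(T^2;\mathbb Z)\to H_2(X;\mathbb Z)$. -/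

import Mathlib

open scoped Manifold ContDiff Topology

noncomputable section

namespace AlmostComplex

universe u

section Structures

variable {E : Type*} [NormedAddCommGroup E] [NormedSpace ℝ E]
  {H : Type*} [TopologicalSpace H] (I : ModelWithCorners ℝ E H)
  (M : Type*) [TopologicalSpace M] [ChartedSpace H M] [IsManifold I ∞ M]

/-- A (smooth) almost complex structure on `M`: a smooth section `J` of the endomorphism bundle of
the tangent bundle with `J ∘ J = -1`. -/
structure AlmostComplexStructure where
  /-- the endomorphism of each tangent space -/
  toFun : ∀ x : M, TangentSpace I x →L[ℝ] TangentSpace I x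
  map_map : ∀ (x : M) (v : TangentSpace I x), toFun x (toFun x v) = -v
  smooth : ContMDiff I (I.prod 𝓘(ℝ, E →L[ℝ] E)) ∞
    (fun x : M => (Bundle.TotalSpace.mk' (E →L[ℝ] E)
      (E := fun x : M => TangentSpace I x →L[ℝ] TangentSpace I x) x (toFun x)))

variable {I M}

/-- `J₀` and `J₁` are deformation equivalent: they are joined by a family `𝒥 t`, `t ∈ [0, 1]`, of
almost complex structures that is smooth on `[0, 1] × M`. -/
def DeformationEquivalent (J₀ J₁ : AlmostComplexStructure I M) : Prop :=
  ∃ 𝒥 : ℝ → AlmostComplexStructure I M, 𝒥 0 = J₀ ∧ 𝒥 1 = J₁ ∧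
    ContMDiffOn (𝓘(ℝ, ℝ).prod I) (I.prod 𝓘(ℝ, E →L[ℝ] E)) ∞
      (fun q : ℝ × M => (Bundle.TotalSpace.mk' (E →L[ℝ] E)
        (E := fun x : M => TangentSpace I x →L[ℝ] TangentSpace I x) q.2 ((𝒥 q.1).toFun q.2)))
      (Set.Icc (0 : ℝ) 1 ×ˢ Set.univ)

/-- The map `f` is pseudoholomorphic: `df ∘ j = J ∘ df`. -/
def IsPseudoholomorphic {E' : Type*} [NormedAddCommGroup E'] [NormedSpace ℝ E']
    {H' : Type*} [TopologicalSpace H'] {I' : ModelWithCorners ℝ E' H'}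
    {N : Type*} [TopologicalSpace N] [ChartedSpace H' N] [IsManifold I' ∞ N]
    (j : AlmostComplexStructure I' N) (J : AlmostComplexStructure I M) (f : N → M) : Prop :=
  ContMDiff I' I ∞ f ∧
    ∀ (z : N) (v : TangentSpace I' z),
      mfderiv I' I f z (j.toFun z v) = J.toFun (f z) (mfderiv I' I f z v)

end Structures

section Forms

variable {E : Type*} [NormedAddCommGroup E] [NormedSpace ℝ E]
  {M : Type*} [TopologicalSpace M] [ChartedSpace E M] [IsManifold 𝓘(ℝ, E) ∞ M]

/-- The expression, in the preferred chart at `p`, of a field `σ` of alternating 2-forms on the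
tangent spaces of `M`, i.e. the pullback of `σ` under the inverse of that chart. It is
meaningful on the (open) target of the chart. -/
def formInChart (σ : ∀ x : M, TangentSpace 𝓘(ℝ, E) x [⋀^Fin 2]→L[ℝ] ℝ) (p : M) :
    E → E [⋀^Fin 2]→L[ℝ] ℝ :=
  fun y => (σ ((extChartAt 𝓘(ℝ, E) p).symm y)).compContinuousLinearMap
    (mfderiv 𝓘(ℝ, E) 𝓘(ℝ, E) (extChartAt 𝓘(ℝ, E) p).symm y)

/-- `σ` is a symplectic form: a smooth, closed, nondegenerate differential 2-form. -/
structure IsSymplecticForm (σ : ∀ x : M, TangentSpace 𝓘(ℝ, E) x [⋀^Fin 2]→L[ℝ] ℝ) : Prop where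
  smooth : ∀ p : M, ContDiffOn ℝ ∞ (formInChart σ p) (extChartAt 𝓘(ℝ, E) p).target
  closed : ∀ p : M, ∀ y ∈ (extChartAt 𝓘(ℝ, E) p).target, extDeriv (formInChart σ p) y = 0
  nondegenerate : ∀ (x : M) (v : TangentSpace 𝓘(ℝ, E) x), (∀ w, σ x ![v, w] = 0) → v = 0

/-- `σ` tames `J`: `σ (v, J v) > 0` for every nonzero tangent vector `v`. -/
def Tames (σ : ∀ x : M, TangentSpace 𝓘(ℝ, E) x [⋀^Fin 2]→L[ℝ] ℝ)
    (J : AlmostComplexStructure 𝓘(ℝ, E) M) : Prop :=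
  ∀ (x : M) (v : TangentSpace 𝓘(ℝ, E) x), v ≠ 0 → 0 < σ x ![v, J.toFun x v]

end Forms

section Torus

/-- The 2-torus. -/
abbrev Torus : Type := Circle × Circle

/-- The second integral singular homology of the space `X`, as a functor. -/
def singularH2 : CategoryTheory.Functor TopCat.{u} AddCommGrpCat.{u} :=
  (AlgebraicTopology.singularHomologyFunctor AddCommGrpCat.{u} 2).obj
    (AddCommGrpCat.of (ULift.{u} ℤ))

/-- The map `f` from the 2-torus is null-homologous: it induces the zero map on second singular
homology with integer coefficients (equivalently, it kills the fundamental class, which generates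
the second homology of the torus). The `ULift` only adjusts the universe. -/
def IsNullHomologous {X : Type u} [TopologicalSpace X] (f : C(Torus, X)) : Prop :=
  singularH2.map (TopCat.ofHom (f.comp ⟨(ULift.down : ULift.{u} Torus → Torus),
    continuous_uliftDown⟩)) = 0

end Torus

end AlmostComplex

end

/-! The obstruction to taming is a holomorphic torus that bounds. If a closed form tamed `J'`, it
would be positive on every tangent plane of the torus, while Stokes makes its integral over the
torus vanish. It therefore suffices to deform `J` inside a small ball of `U` until a flat torus
`|z₁| = |z₂| = 1` becomes holomorphic; the torus is null-homologous because it contracts radially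
within the chart.

The deformation is explicit. At the centre, `J₀` splits off a copy of `ℂ × ℂ`, where `i` and `quatJ`
generate the quaternions. The structure `z₁ z₂ · quatJ` sends `(i z₁, 0)` to `(0, i z₂)` at points
of the torus, so it preserves the tangent planes there. It is joined to `i` by normalising `(1 -
σ|c|²) i + σ c · quatJ` with `c = z₁ z₂`: the two coefficients never vanish together, even where `c
= 0`. Since `J` is not constant in the chart, it is first written as a conjugate of `J₀` by
`intertwiner`; the conjugating factor is moved to `1` with the same cutoff `σ`. This is
`exists_local_deformation`, and `contMDiff_glueFun` carries it to `X`.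

The Stokes argument is `not_forall_torus_pos`, applied to the cone over the torus. The complex
structure on the torus comes from `exists_induced_almostComplexStructure`, and the embedding from
the inverse function theorem in `exists_straightening`. -/

namespace AlmostComplex

/-! ### Linear algebra: a complex plane inside the tangent space -/

section Splitting

variable {E : Type*} [NormedAddCommGroup E] [NormedSpace ℝ E] [FiniteDimensional ℝ E]

/-- A linear complex structure on a real vector space of dimension at least four splits off
a copy of `ℂ × ℂ`. -/
theorem exists_complex_splitting (hdim : 4 ≤ Module.finrank ℝ E) (J₀ : E →L[ℝ] E)
    (hJ : ∀ v, J₀ (J₀ v) = -v) :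
    ∃ (ι : ℂ × ℂ →L[ℝ] E) (π : E →L[ℝ] ℂ × ℂ), (∀ z, π (ι z) = z) ∧
      (∀ z, ι (Complex.I • z) = J₀ (ι z)) ∧ ∀ v, π (J₀ v) = Complex.I • π v := by
  -- `J₀` makes `E` a complex vector space of dimension at least two; two vectors of a complex basis
  -- span the summand.
  let φ : ℂ →ₐ[ℝ] Module.End ℝ E := Complex.lift ⟨J₀.toLinearMap, by
    ext v; simp [hJ]⟩
  let _ : Module ℂ E := Module.compHom E φ.toRingHom
  have hI : ∀ v : E, Complex.I • v = J₀ v := fun v => by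
    change φ Complex.I v = _
    simp [φ]
  have : IsScalarTower ℝ ℂ E := ⟨fun r z v => by
    change φ (r • z) v = r • φ z v
    simp⟩
  have : Module.Finite ℂ E := Module.Finite.of_restrictScalars_finite ℝ ℂ E
  have h2 : 2 ≤ Module.finrank ℂ E := by
    have := Module.finrank_mul_finrank ℝ ℂ E
    rw [Complex.finrank_real_complex] at this
    omega
  let b := Module.finBasis ℂ E
  let i0 : Fin (Module.finrank ℂ E) := ⟨0, by omega⟩
  let i1 : Fin (Module.finrank ℂ E) := ⟨1, by omega⟩
  have h01 : i0 ≠ i1 := by simp [i0, i1]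
  let ιl : ℂ × ℂ →ₗ[ℂ] E :=
    (LinearMap.toSpanSingleton ℂ E (b i0)).coprod (LinearMap.toSpanSingleton ℂ E (b i1))
  let πl : E →ₗ[ℂ] ℂ × ℂ := (b.coord i0).prod (b.coord i1)
  refine ⟨LinearMap.toContinuousLinearMap (ιl.restrictScalars ℝ),
    LinearMap.toContinuousLinearMap (πl.restrictScalars ℝ), fun z => ?_, fun z => ?_, fun v => ?_⟩
  · ext1 <;> simp [ιl, πl, h01, h01.symm]
  · simp only [LinearMap.coe_toContinuousLinearMap', LinearMap.coe_restrictScalars]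
    rw [map_smul, hI]
  · simp only [LinearMap.coe_toContinuousLinearMap', LinearMap.coe_restrictScalars]
    rw [← hI, map_smul]

end Splitting

/-! ### Quaternionic complex structures on `ℂ × ℂ` -/

section Plane

/-- Multiplication by `i` on `ℂ × ℂ`. -/
noncomputable def mulI : ℂ × ℂ →L[ℝ] ℂ × ℂ :=
  (Complex.I • ContinuousLinearMap.id ℂ (ℂ × ℂ)).restrictScalars ℝ

/-- The quaternionic structure `(w₁, w₂) ↦ (conj w₂, -conj w₁)` on `ℂ × ℂ`. -/
noncomputable def quatJ : ℂ × ℂ →L[ℝ] ℂ × ℂ :=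
  (Complex.conjCLE.toContinuousLinearMap.comp (ContinuousLinearMap.snd ℝ ℂ ℂ)).prod
    (-(Complex.conjCLE.toContinuousLinearMap.comp (ContinuousLinearMap.fst ℝ ℂ ℂ)))

@[simp] theorem mulI_apply (w : ℂ × ℂ) : mulI w = (Complex.I * w.1, Complex.I * w.2) := rfl

@[simp] theorem quatJ_apply (w : ℂ × ℂ) :
    quatJ w = (starRingEnd ℂ w.2, -starRingEnd ℂ w.1) := rfl

/-- The endomorphism `a i + g · quatJ` of `ℂ × ℂ`, normalised to have square `-1`. -/
noncomputable def planeStructure (a : ℝ) (g : ℂ) : ℂ × ℂ →L[ℝ] ℂ × ℂ :=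
  (Real.sqrt (a ^ 2 + Complex.normSq g))⁻¹ •
    (a • mulI + (g.re • quatJ + g.im • mulI.comp quatJ))

theorem planeStructure_apply (a : ℝ) (g : ℂ) (w : ℂ × ℂ) :
    planeStructure a g w = (Real.sqrt (a ^ 2 + Complex.normSq g))⁻¹ •
      (a * Complex.I * w.1 + g * starRingEnd ℂ w.2,
        a * Complex.I * w.2 - g * starRingEnd ℂ w.1) := by
  simp only [planeStructure, smul_apply, add_apply, ContinuousLinearMap.comp_apply, mulI_apply, quatJ_apply]
  congr 1
  have hg := Complex.re_add_im g
  ext1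
  · simp only [Prod.fst_add, Prod.smul_fst, Complex.real_smul]
    linear_combination starRingEnd ℂ w.2 * hg
  · simp only [Prod.snd_add, Prod.smul_snd, Complex.real_smul]
    linear_combination -starRingEnd ℂ w.1 * hg

/-- `mulI`, `quatJ` and their product are anticommuting square roots of `-1`, so a real combination
of them squares to minus the sum of the squared coefficients. -/
theorem planeStructure_sq {a : ℝ} {g : ℂ} (h : 0 < a ^ 2 + Complex.normSq g) (w : ℂ × ℂ) :
    planeStructure a g (planeStructure a g w) = -w := by
  have hs := Real.sq_sqrt h.le
  have hne : Real.sqrt (a ^ 2 + Complex.normSq g) ≠ 0 := (Real.sqrt_pos.2 h).ne'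
  rw [planeStructure_apply a g w, map_smul, planeStructure_apply, smul_smul, ← mul_inv, ← sq, hs,
    inv_smul_eq_iff₀ h.ne']
  have hg := Complex.mul_conj g
  ext1
  · simp only [map_sub, map_mul, Complex.conj_ofReal, Complex.conj_I, Complex.conj_conj,
      Prod.smul_fst, Prod.fst_neg, Complex.real_smul, Complex.ofReal_add, Complex.ofReal_pow, ← hg]
    linear_combination (a ^ 2 * w.1 : ℂ) * Complex.I_sq
  · simp only [map_add, map_mul, Complex.conj_ofReal, Complex.conj_I, Complex.conj_conj,
      Prod.smul_snd, Prod.snd_neg, Complex.real_smul, Complex.ofReal_add, Complex.ofReal_pow, ← hg]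
    linear_combination (a ^ 2 * w.2 : ℂ) * Complex.I_sq

theorem planeStructure_one_zero : planeStructure 1 0 = mulI := by
  refine ContinuousLinearMap.ext fun w => ?_
  simp [planeStructure_apply]

theorem _root_.ContDiffWithinAt.planeStructure {V : Type*} [NormedAddCommGroup V] [NormedSpace ℝ V]
    {a : V → ℝ} {g : V → ℂ} {s : Set V} {x : V} (ha : ContDiffWithinAt ℝ ∞ a s x)
    (hg : ContDiffWithinAt ℝ ∞ g s x) (h : 0 < a x ^ 2 + Complex.normSq (g x)) :
    ContDiffWithinAt ℝ ∞ (fun y => planeStructure (a y) (g y)) s x := by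
  have hre : ContDiffWithinAt ℝ ∞ (fun y => (g y).re) s x :=
    Complex.reCLM.contDiff.contDiffAt.comp_contDiffWithinAt x hg
  have him : ContDiffWithinAt ℝ ∞ (fun y => (g y).im) s x :=
    Complex.imCLM.contDiff.contDiffAt.comp_contDiffWithinAt x hg
  unfold AlmostComplex.planeStructure
  have hD : ContDiffWithinAt ℝ ∞ (fun y => a y ^ 2 + Complex.normSq (g y)) s x := by
    simp only [Complex.normSq_apply]
    exact (ha.pow 2).add ((hre.mul hre).add (him.mul him))
  have hn : ContDiffWithinAt ℝ ∞ (fun y => (Real.sqrt (a y ^ 2 + Complex.normSq (g y)))⁻¹) s x :=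
    (hD.sqrt h.ne').inv (Real.sqrt_pos.2 h).ne'
  refine hn.smul ?_
  exact (ha.smul contDiffWithinAt_const).add
    ((hre.smul contDiffWithinAt_const).add (him.smul contDiffWithinAt_const))

end Plane

/-! ### Local deformation in a chart -/

section Deformation

variable {E : Type*} [NormedAddCommGroup E] [NormedSpace ℝ E]

/-- The endomorphism of `E` that is `N` on the summand `ι (ℂ × ℂ)` and `J₀` on the kernel of `π`. -/
noncomputable def blockStructure (J₀ : E →L[ℝ] E) (ι : ℂ × ℂ →L[ℝ] E) (π : E →L[ℝ] ℂ × ℂ)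
    (N : ℂ × ℂ →L[ℝ] ℂ × ℂ) : E →L[ℝ] E :=
  J₀ - J₀.comp (ι.comp π) + ι.comp (N.comp π)

theorem blockStructure_apply_ι {J₀ : E →L[ℝ] E} {ι : ℂ × ℂ →L[ℝ] E} {π : E →L[ℝ] ℂ × ℂ}
    (h : ∀ z, π (ι z) = z) (N : ℂ × ℂ →L[ℝ] ℂ × ℂ) (w : ℂ × ℂ) :
    blockStructure J₀ ι π N (ι w) = ι (N w) := by
  simp [blockStructure, h]

theorem blockStructure_mulI {J₀ : E →L[ℝ] E} {ι : ℂ × ℂ →L[ℝ] E} {π : E →L[ℝ] ℂ × ℂ}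
    (hι : ∀ z, ι (Complex.I • z) = J₀ (ι z)) : blockStructure J₀ ι π mulI = J₀ := by
  ext v
  have : mulI (π v) = Complex.I • π v := rfl
  simp only [blockStructure, add_apply, sub_apply, ContinuousLinearMap.comp_apply, this, hι]
  abel

/-- `ι ∘ π` is a projection commuting with `J₀`, so its image and kernel are both invariant and the
squares are computed on each separately. -/
theorem blockStructure_sq {J₀ : E →L[ℝ] E} {ι : ℂ × ℂ →L[ℝ] E} {π : E →L[ℝ] ℂ × ℂ}
    (hJ : ∀ v, J₀ (J₀ v) = -v) (h : ∀ z, π (ι z) = z) (hι : ∀ z, ι (Complex.I • z) = J₀ (ι z))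
    (hπ : ∀ v, π (J₀ v) = Complex.I • π v) {N : ℂ × ℂ →L[ℝ] ℂ × ℂ} (hN : ∀ w, N (N w) = -w)
    (v : E) : blockStructure J₀ ι π N (blockStructure J₀ ι π N v) = -v := by
  simp only [blockStructure, add_apply, sub_apply, ContinuousLinearMap.comp_apply, map_add, map_sub,
    hπ, h, hJ, hN, ← hι, map_neg, sub_self, zero_add, smul_smul,
    Complex.I_mul_I, neg_smul, one_smul]
  abel

/-- The half-way intertwiner: `(1 - J J₀) / 2` conjugates `J₀` to `J`. -/
noncomputable def intertwiner (J J₀ : E →L[ℝ] E) : E →L[ℝ] E :=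
  (2⁻¹ : ℝ) • (1 - J * J₀)

/-- Both sides equal `(J + J₀) / 2`. -/
theorem intertwiner_mul {J J₀ : E →L[ℝ] E} (hJ : J * J = -1) (hJ₀ : J₀ * J₀ = -1) :
    intertwiner J J₀ * J₀ = J * intertwiner J J₀ := by
  simp only [intertwiner, smul_mul_assoc, mul_smul_comm, sub_mul, mul_sub, one_mul, mul_one,
    mul_assoc, hJ₀, ← mul_assoc J J J₀, hJ]
  congr 1
  simp only [mul_neg, mul_one, neg_mul, one_mul]
  abel

theorem intertwiner_self {J₀ : E →L[ℝ] E} (hJ₀ : J₀ * J₀ = -1) : intertwiner J₀ J₀ = 1 := by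
  rw [intertwiner, hJ₀, sub_neg_eq_add, ← two_smul ℝ (1 : E →L[ℝ] E), smul_smul]
  norm_num

/-- The segment from `A` to `1` stays in the open unit ball about `1`, where the Neumann series
inverts. -/
theorem isUnit_one_add_smul_sub [CompleteSpace E] {A : E →L[ℝ] E} (hA : ‖A - 1‖ < 1) {s : ℝ}
    (h0 : 0 ≤ s) (h1 : s ≤ 1) : IsUnit (1 + (1 - s) • (A - 1)) := by
  have : ‖(s - 1) • (A - 1)‖ < 1 := by
    rw [norm_smul, Real.norm_eq_abs, abs_sub_comm, abs_of_nonneg (by linarith)]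
    nlinarith [norm_nonneg (A - 1)]
  have h := isUnit_one_sub_of_norm_lt_one this
  rwa [show (1 : E →L[ℝ] E) - (s - 1) • (A - 1) = 1 + (1 - s) • (A - 1) by
    rw [sub_eq_add_neg, ← neg_smul, neg_sub]] at h

theorem conj_mul_conj {R : Type*} [Ring R] {P M : R} (hP : IsUnit P) (hM : M * M = -1) :
    (P * M * Ring.inverse P) * (P * M * Ring.inverse P) = -1 := by
  calc _ = P * M * (Ring.inverse P * P) * M * Ring.inverse P := by noncomm_ring
    _ = P * (M * M) * Ring.inverse P := by rw [Ring.inverse_mul_cancel _ hP]; noncomm_ring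
    _ = -(P * Ring.inverse P) := by rw [hM]; noncomm_ring
    _ = -1 := by rw [Ring.mul_inverse_cancel _ hP]

theorem mul_self_eq_neg_one_iff {T : E →L[ℝ] E} : T * T = -1 ↔ ∀ v, T (T v) = -v := by
  rw [ContinuousLinearMap.ext_iff]
  rfl

variable [FiniteDimensional ℝ E]

/-- A smooth field of complex structures near `y₀` can be deformed, through such fields and
with compact support, to one for which a small flat torus around `y₀` is holomorphic. -/
theorem exists_local_deformation (hdim : 4 ≤ Module.finrank ℝ E) {V₀ : Set E} (hV₀ : IsOpen V₀)
    {y₀ : E} (hy₀ : y₀ ∈ V₀) {Jc : E → E →L[ℝ] E} (hs : ContDiffOn ℝ ∞ Jc V₀)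
    (hJ : ∀ y ∈ V₀, ∀ v, Jc y (Jc y v) = -v) :
    ∃ (V K : Set E) (Θ : ℝ → E → E →L[ℝ] E) (τ : ℂ × ℂ →L[ℝ] E),
      IsOpen V ∧ V ⊆ V₀ ∧ IsCompact K ∧ K ⊆ V ∧
      ContDiffOn ℝ ∞ (fun q : ℝ × E => Θ q.1 q.2) (Set.univ ×ˢ V) ∧
      (∀ t, ∀ y ∈ V, ∀ v, Θ t y (Θ t y v) = -v) ∧
      (∀ y ∈ V, Θ 0 y = Jc y) ∧
      (∀ t, ∀ y ∈ V \ K, Θ t y = Jc y) ∧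
      Function.Injective τ ∧
      (∀ z, ‖z‖ ≤ 1 → y₀ + τ z ∈ V) ∧
      ∀ z w : ℂ × ℂ, ‖z.1‖ = 1 → ‖z.2‖ = 1 → Θ 1 (y₀ + τ z) (τ w) =
        τ (z.1 * z.2 * starRingEnd ℂ w.2, -(z.1 * z.2 * starRingEnd ℂ w.1)) := by
  set J₀ := Jc y₀ with hJ₀def
  have hJ₀ : ∀ v, J₀ (J₀ v) = -v := hJ y₀ hy₀
  have hJ₀' : J₀ * J₀ = -1 := mul_self_eq_neg_one_iff.2 hJ₀
  obtain ⟨ι, π, hπι, hι, hπ⟩ := exists_complex_splitting hdim J₀ hJ₀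
  let A : E → E →L[ℝ] E := fun y => intertwiner (Jc y) J₀
  have hA : ContDiffOn ℝ ∞ A V₀ :=
    (contDiffOn_const.sub (hs.mul contDiffOn_const)).const_smul (2⁻¹ : ℝ)
  have hAy₀ : A y₀ = 1 := intertwiner_self hJ₀'
  -- On `V` the intertwiner and its whole segment to `1` are invertible.
  let V : Set E := V₀ ∩ {y | ‖A y - 1‖ < 1}
  have hVo : IsOpen V := by
    have hc : ContinuousOn (fun y => ‖A y - 1‖) V₀ := (hA.continuousOn.sub continuousOn_const).norm
    exact hc.isOpen_inter_preimage hV₀ isOpen_Iio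
  have hyV : y₀ ∈ V := ⟨hy₀, by simp [hAy₀]⟩
  obtain ⟨r, hr, hrV⟩ := Metric.nhds_basis_closedBall.mem_iff.1 (hVo.mem_nhds hyV)
  let χ : ContDiffBump y₀ := ⟨r / 2, r, by positivity, by linarith⟩
  -- The scale `ε` puts the image of the closed unit bidisc in the half ball, where `χ = 1`.
  obtain ⟨ε, hε, hει⟩ : ∃ ε : ℝ, 0 < ε ∧ ε * ‖ι‖ ≤ r / 2 :=
    ⟨r / 2 / (‖ι‖ + 1), by positivity, by
      rw [div_mul_eq_mul_div, div_le_iff₀ (by positivity)]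
      nlinarith [norm_nonneg ι]⟩
  -- Cutting off in time as well keeps `σ` in `[0, 1]` for every real `t`, so the family exists for
  -- all times.
  let σ : ℝ × E → ℝ := fun q => Real.smoothTransition q.1 * χ q.2
  let ζ : E → ℂ × ℂ := fun y => π (ε⁻¹ • (y - y₀))
  let c : E → ℂ := fun y => (ζ y).1 * (ζ y).2
  -- With `1 - σ` as first coefficient, both would vanish at `σ = 1`, `c = 0`. The factor `|c|²`
  -- avoids this and still kills the first coefficient on the torus, where `|c| = 1`.
  let N : ℝ × E → ℂ × ℂ →L[ℝ] ℂ × ℂ := fun q =>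
    planeStructure (1 - σ q * Complex.normSq (c q.2)) (σ q * c q.2)
  let P : ℝ × E → E →L[ℝ] E := fun q => 1 + (1 - σ q) • (A q.2 - 1)
  let M : ℝ × E → E →L[ℝ] E := fun q => blockStructure J₀ ι π (N q)
  have hσ0 : ∀ q, 0 ≤ σ q := fun q => mul_nonneg (Real.smoothTransition.nonneg _) χ.nonneg
  have hσ1 : ∀ q, σ q ≤ 1 := fun q =>
    mul_le_one₀ (Real.smoothTransition.le_one _) χ.nonneg χ.le_one
  have hσs : ContDiff ℝ ∞ σ :=
    (Real.smoothTransition.contDiff.comp contDiff_fst).mul (χ.contDiff.comp contDiff_snd)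
  have hζs : ContDiff ℝ ∞ ζ :=
    π.contDiff.comp (contDiff_const.smul (contDiff_id.sub contDiff_const))
  have hcs : ContDiff ℝ ∞ c := (contDiff_fst.comp hζs).mul (contDiff_snd.comp hζs)
  have hpos : ∀ q : ℝ × E, 0 < (1 - σ q * Complex.normSq (c q.2)) ^ 2 +
      Complex.normSq (σ q * c q.2) := by
    intro q
    rcases eq_or_ne ((σ q : ℂ) * c q.2) 0 with h | h
    · have : σ q * Complex.normSq (c q.2) = 0 := by
        rcases mul_eq_zero.1 h with h | h
        · rw [Complex.ofReal_eq_zero.1 h, zero_mul]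
        · rw [h, map_zero, mul_zero]
      rw [h, this]
      simp
    · have := Complex.normSq_pos.2 h
      positivity
  have hNs : ContDiff ℝ ∞ N := by
    rw [← contDiffOn_univ]
    intro q _
    have hc' : ContDiff ℝ ∞ fun q : ℝ × E => c q.2 := hcs.comp contDiff_snd
    have hre : ContDiff ℝ ∞ fun q : ℝ × E => (c q.2).re := Complex.reCLM.contDiff.comp hc'
    have him : ContDiff ℝ ∞ fun q : ℝ × E => (c q.2).im := Complex.imCLM.contDiff.comp hc'
    refine ContDiffWithinAt.planeStructure (ContDiff.contDiffWithinAt ?_)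
      (ContDiff.contDiffWithinAt ?_) (hpos q)
    · simp only [Complex.normSq_apply]
      exact contDiff_const.sub (hσs.mul ((hre.mul hre).add (him.mul him)))
    · exact (Complex.ofRealCLM.contDiff.comp hσs).mul hc'
  have hMs : ContDiff ℝ ∞ M :=
    contDiff_const.add (contDiff_const.clm_comp (hNs.clm_comp contDiff_const))
  have hPs : ContDiffOn ℝ ∞ P (Set.univ ×ˢ V) := by
    refine contDiffOn_const.add ((contDiff_const.sub hσs).contDiffOn.smul (ContDiffOn.sub ?_
      contDiffOn_const))
    exact hA.comp contDiffOn_snd fun q hq => hq.2.1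
  have hPu : ∀ q : ℝ × E, q.2 ∈ V → IsUnit (P q) := fun q hq =>
    isUnit_one_add_smul_sub hq.2 (hσ0 q) (hσ1 q)
  have hMM : ∀ q, M q * M q = -1 := fun q => mul_self_eq_neg_one_iff.2
    (blockStructure_sq hJ₀ hπι hι hπ (planeStructure_sq (hpos q)))
  -- Where `σ = 0` the formula is `A J₀ A⁻¹`, which is `Jc` by the intertwining relation. This
  -- covers both time zero and the complement of the support of `χ`.
  have hzero : ∀ q : ℝ × E, q.2 ∈ V → σ q = 0 → P q * M q * Ring.inverse (P q) = Jc q.2 := by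
    intro q hq h
    have hM : M q = J₀ := by
      simp only [M, N, h, zero_mul, sub_zero, Complex.ofReal_zero, planeStructure_one_zero]
      exact blockStructure_mulI hι
    have hP : P q = A q.2 := by simp [P, h]
    have hu := hPu q hq
    rw [hM, hP] at *
    rw [intertwiner_mul (mul_self_eq_neg_one_iff.2 (hJ _ hq.1)) hJ₀', mul_assoc,
      Ring.mul_inverse_cancel _ hu, mul_one]
  have hball : ∀ z : ℂ × ℂ, ‖z‖ ≤ 1 → y₀ + ε • ι z ∈ Metric.closedBall y₀ (r / 2) := by
    intro z hz
    rw [mem_closedBall_iff_norm, add_sub_cancel_left, norm_smul, Real.norm_of_nonneg hε.le]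
    have := (ι.le_opNorm z).trans (mul_le_of_le_one_right (norm_nonneg ι) hz)
    nlinarith
  refine ⟨V, Metric.closedBall y₀ r, fun t y => P (t, y) * M (t, y) * Ring.inverse (P (t, y)),
    ε • ι, hVo, Set.inter_subset_left, isCompact_closedBall y₀ r, hrV, ?_, ?_, ?_, ?_, ?_, ?_, ?_⟩
  · refine (hPs.mul hMs.contDiffOn).mul ?_
    intro q hq
    obtain ⟨u, hu⟩ := hPu q hq.2
    have := contDiffAt_ringInverse ℝ (n := ∞) u
    rw [hu] at this
    exact this.comp_contDiffWithinAt q (hPs q hq)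
  · intro t y hy
    exact mul_self_eq_neg_one_iff.1 (conj_mul_conj (hPu (t, y) hy) (hMM (t, y)))
  · intro y hy
    exact hzero (0, y) hy (by simp [σ])
  · intro t y hy
    refine hzero (t, y) hy.1 ?_
    have : χ y = 0 := χ.zero_of_le_dist (by simpa using (le_of_lt (by simpa using hy.2)))
    simp [σ, this]
  · intro z w h
    have h' := congrArg (fun v => π (ε⁻¹ • v)) h
    simpa [smul_smul, hε.ne', hπι] using h'
  · intro z hz
    exact hrV (Metric.closedBall_subset_closedBall (by linarith) (hball z hz))
  · intro z w h1 h2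
    have hz : ‖z‖ ≤ 1 := by rw [Prod.norm_def, h1, h2, max_self]
    have hσ : σ (1, y₀ + ε • ι z) = 1 := by
      simp only [σ, Real.smoothTransition.one, one_mul]
      exact χ.one_of_mem_closedBall (hball z hz)
    have hζ : ζ (y₀ + ε • ι z) = z := by
      simp [ζ, smul_smul, hε.ne', hπι]
    have hc : c (y₀ + ε • ι z) = z.1 * z.2 := by simp only [c, hζ]
    have hn : Complex.normSq (z.1 * z.2) = 1 := by
      rw [Complex.normSq_eq_norm_sq, norm_mul, h1, h2]; norm_num
    have hP : P (1, y₀ + ε • ι z) = 1 := by simp [P, hσ]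
    simp only [smul_apply, hP, one_mul, Ring.inverse_one, mul_one, M, map_smul,
      blockStructure_apply_ι hπι, N, hσ, hc, hn, planeStructure_apply]
    congr 2
    simp [hn]

end Deformation

/-! ### Transfer between the chart and the manifold -/

section Gluing

variable {E : Type*} [NormedAddCommGroup E] [NormedSpace ℝ E]
  {X : Type*} [TopologicalSpace X] [ChartedSpace E X] [IsManifold 𝓘(ℝ, E) ∞ X]

/-- The differential at `x` of the preferred chart at `p`. -/
noncomputable def toCoord (p x : X) : TangentSpace 𝓘(ℝ, E) x →L[ℝ] E :=
  (trivializationAt E (TangentSpace 𝓘(ℝ, E)) p).continuousLinearMapAt ℝ x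

/-- The inverse of the differential at `x` of the preferred chart at `p`. -/
noncomputable def ofCoord (p x : X) : E →L[ℝ] TangentSpace 𝓘(ℝ, E) x :=
  (trivializationAt E (TangentSpace 𝓘(ℝ, E)) p).symmL ℝ x

theorem toCoord_ofCoord {p x : X} (hx : x ∈ (chartAt E p).source) (v : E) :
    toCoord p x (ofCoord p x v) = v :=
  (trivializationAt E (TangentSpace 𝓘(ℝ, E)) p).continuousLinearMapAt_symmL hx v

theorem ofCoord_toCoord {p x : X} (hx : x ∈ (chartAt E p).source) (v : TangentSpace 𝓘(ℝ, E) x) :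
    ofCoord p x (toCoord p x v) = v :=
  (trivializationAt E (TangentSpace 𝓘(ℝ, E)) p).symmL_continuousLinearMapAt hx v

/-- Smoothness of a field of endomorphisms of the tangent spaces can be read in a chart. -/
theorem contMDiffAt_endomorphism_iff {E' H' Y : Type*} [NormedAddCommGroup E'] [NormedSpace ℝ E']
    [TopologicalSpace H'] {I' : ModelWithCorners ℝ E' H'} [TopologicalSpace Y] [ChartedSpace H' Y]
    {b : Y → X} (T : ∀ y : Y, TangentSpace 𝓘(ℝ, E) (b y) →L[ℝ] TangentSpace 𝓘(ℝ, E) (b y))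
    {p : X} {y₀ : Y} (h : b y₀ ∈ (chartAt E p).source) :
    ContMDiffAt I' (𝓘(ℝ, E).prod 𝓘(ℝ, E →L[ℝ] E)) ∞
      (fun y => (Bundle.TotalSpace.mk' (E →L[ℝ] E)
        (E := fun x : X => TangentSpace 𝓘(ℝ, E) x →L[ℝ] TangentSpace 𝓘(ℝ, E) x) (b y) (T y))) y₀ ↔
    ContMDiffAt I' 𝓘(ℝ, E) ∞ b y₀ ∧
      ContMDiffAt I' 𝓘(ℝ, E →L[ℝ] E) ∞
        (fun y => (toCoord p (b y)).comp ((T y).comp (ofCoord p (b y)))) y₀ := by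
  rw [(trivializationAt (E →L[ℝ] E)
    (fun x : X => TangentSpace 𝓘(ℝ, E) x →L[ℝ] TangentSpace 𝓘(ℝ, E) x) p).contMDiffAt_iff]
  · rfl
  · rw [hom_trivializationAt_source]
    exact ⟨h, h⟩

/-- The expression of an almost complex structure in the preferred chart at `p`. -/
noncomputable def coordStructure (J : AlmostComplexStructure 𝓘(ℝ, E) X) (p : X) (y : E) :
    E →L[ℝ] E :=
  (toCoord p ((extChartAt 𝓘(ℝ, E) p).symm y)).comp
    ((J.toFun ((extChartAt 𝓘(ℝ, E) p).symm y)).comp (ofCoord p ((extChartAt 𝓘(ℝ, E) p).symm y)))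

theorem contDiffOn_coordStructure (J : AlmostComplexStructure 𝓘(ℝ, E) X) (p : X) :
    ContDiffOn ℝ ∞ (coordStructure J p) (extChartAt 𝓘(ℝ, E) p).target := by
  rw [← contMDiffOn_iff_contDiffOn]
  have h : ContMDiffOn 𝓘(ℝ, E) 𝓘(ℝ, E →L[ℝ] E) ∞
      (fun x : X => (toCoord p x).comp ((J.toFun x).comp (ofCoord p x)))
      (extChartAt 𝓘(ℝ, E) p).source := by
    intro x hx
    rw [extChartAt_source] at hx
    exact ((contMDiffAt_endomorphism_iff (b := id) J.toFun hx).1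
      J.smooth.contMDiffAt).2.contMDiffWithinAt
  exact h.comp (contMDiffOn_extChartAt_symm p) (extChartAt 𝓘(ℝ, E) p).mapsTo_symm

theorem coordStructure_sq (J : AlmostComplexStructure 𝓘(ℝ, E) X) (p : X) {y : E}
    (hy : y ∈ (extChartAt 𝓘(ℝ, E) p).target) (v : E) :
    coordStructure J p y (coordStructure J p y v) = -v := by
  have hx : (extChartAt 𝓘(ℝ, E) p).symm y ∈ (chartAt E p).source := by
    simpa using (extChartAt 𝓘(ℝ, E) p).map_target hy
  simp only [coordStructure, ContinuousLinearMap.comp_apply, ofCoord_toCoord hx, J.map_map, map_neg,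
    toCoord_ofCoord hx]

theorem ofCoord_coordStructure (J : AlmostComplexStructure 𝓘(ℝ, E) X) {p x : X}
    (hx : x ∈ (chartAt E p).source) :
    (ofCoord p x).comp ((coordStructure J p (extChartAt 𝓘(ℝ, E) p x)).comp (toCoord p x)) =
      J.toFun x := by
  have hx' : (extChartAt 𝓘(ℝ, E) p).symm (extChartAt 𝓘(ℝ, E) p x) = x :=
    (extChartAt 𝓘(ℝ, E) p).left_inv (by simpa using hx)
  ext v
  simp only [coordStructure, ContinuousLinearMap.comp_apply]
  rw [hx', ofCoord_toCoord hx, ofCoord_toCoord hx]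

open Classical in
/-- The field of endomorphisms given by `Θ` in the chart at `p` over `V`, and by `J` elsewhere. -/
noncomputable def glueFun (J : AlmostComplexStructure 𝓘(ℝ, E) X) (p : X) (V : Set E)
    (Θ : E → E →L[ℝ] E) (x : X) : TangentSpace 𝓘(ℝ, E) x →L[ℝ] TangentSpace 𝓘(ℝ, E) x :=
  if x ∈ (chartAt E p).source ∧ extChartAt 𝓘(ℝ, E) p x ∈ V then
    (ofCoord p x).comp ((Θ (extChartAt 𝓘(ℝ, E) p x)).comp (toCoord p x))
  else J.toFun x

theorem glueFun_of_mem (J : AlmostComplexStructure 𝓘(ℝ, E) X) {p x : X} {V : Set E}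
    (Θ : E → E →L[ℝ] E) (hx : x ∈ (chartAt E p).source) (hV : extChartAt 𝓘(ℝ, E) p x ∈ V) :
    glueFun J p V Θ x = (ofCoord p x).comp ((Θ (extChartAt 𝓘(ℝ, E) p x)).comp (toCoord p x)) :=
  if_pos ⟨hx, hV⟩

theorem glueFun_eq (J : AlmostComplexStructure 𝓘(ℝ, E) X) {p x : X} {V : Set E}
    {Θ : E → E →L[ℝ] E} (h : x ∈ (chartAt E p).source → extChartAt 𝓘(ℝ, E) p x ∈ V →
      Θ (extChartAt 𝓘(ℝ, E) p x) = coordStructure J p (extChartAt 𝓘(ℝ, E) p x)) :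
    glueFun J p V Θ x = J.toFun x := by
  unfold glueFun
  split_ifs with hx
  · rw [h hx.1 hx.2, ofCoord_coordStructure J hx.1]
  · rfl

theorem glueFun_sq (J : AlmostComplexStructure 𝓘(ℝ, E) X) {p : X} {V : Set E}
    {Θ : E → E →L[ℝ] E} (hΘ : ∀ y ∈ V, ∀ v, Θ y (Θ y v) = -v) (x : X)
    (v : TangentSpace 𝓘(ℝ, E) x) : glueFun J p V Θ x (glueFun J p V Θ x v) = -v := by
  unfold glueFun
  split_ifs with hx
  · simp only [ContinuousLinearMap.comp_apply, toCoord_ofCoord hx.1, hΘ _ hx.2, map_neg,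
      ofCoord_toCoord hx.1]
  · exact J.map_map x v

/-- Two open sets cover `X`: the part of the chart over `V`, where the field is `Θ` in coordinates,
and the complement of the image of `K`, where it is `J`. That image is closed because it is compact
and `X` is Hausdorff. -/
theorem contMDiff_glueFun [T2Space X] (J : AlmostComplexStructure 𝓘(ℝ, E) X) {p : X}
    {V K : Set E} (hV : IsOpen V) (hVt : V ⊆ (extChartAt 𝓘(ℝ, E) p).target) (hK : IsCompact K)
    (hKV : K ⊆ V) {Θ : ℝ → E → E →L[ℝ] E}
    (hs : ContDiffOn ℝ ∞ (fun q : ℝ × E => Θ q.1 q.2) (Set.univ ×ˢ V))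
    (hΘ : ∀ t, ∀ y ∈ V \ K, Θ t y = coordStructure J p y) :
    ContMDiff (𝓘(ℝ, ℝ).prod 𝓘(ℝ, E)) (𝓘(ℝ, E).prod 𝓘(ℝ, E →L[ℝ] E)) ∞
      (fun q : ℝ × X => (Bundle.TotalSpace.mk' (E →L[ℝ] E)
        (E := fun x : X => TangentSpace 𝓘(ℝ, E) x →L[ℝ] TangentSpace 𝓘(ℝ, E) x) q.2
        (glueFun J p V (Θ q.1) q.2))) := by
  have hKX : IsClosed ((extChartAt 𝓘(ℝ, E) p).symm '' K) :=
    (hK.image_of_continuousOn ((continuousOn_extChartAt_symm p).mono (hKV.trans hVt))).isClosed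
  have hW : IsOpen ((chartAt E p).source ∩ extChartAt 𝓘(ℝ, E) p ⁻¹' V) := by
    have := (continuousOn_extChartAt (I := 𝓘(ℝ, E)) p).isOpen_inter_preimage
      (isOpen_extChartAt_source p) hV
    rwa [extChartAt_source] at this
  rintro ⟨t, x⟩
  by_cases hx : x ∈ (chartAt E p).source ∩ extChartAt 𝓘(ℝ, E) p ⁻¹' V
  · refine (contMDiffAt_endomorphism_iff (b := Prod.snd)
      (fun q : ℝ × X => glueFun J p V (Θ q.1) q.2) hx.1).2 ⟨contMDiffAt_snd, ?_⟩
    have h1 : ContMDiffAt (𝓘(ℝ, ℝ).prod 𝓘(ℝ, E)) 𝓘(ℝ, E →L[ℝ] E) ∞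
        (fun q : ℝ × X => Θ q.1 (extChartAt 𝓘(ℝ, E) p q.2)) (t, x) := by
      have h2 : ContMDiffAt 𝓘(ℝ, ℝ × E) 𝓘(ℝ, E →L[ℝ] E) ∞ (fun q : ℝ × E => Θ q.1 q.2)
          (t, extChartAt 𝓘(ℝ, E) p x) :=
        (hs.contDiffAt ((isOpen_univ.prod hV).mem_nhds
          (Set.mk_mem_prod (Set.mem_univ t) hx.2))).contMDiffAt
      have h3 : ContMDiffAt (𝓘(ℝ, ℝ).prod 𝓘(ℝ, E)) 𝓘(ℝ, ℝ × E) ∞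
          (fun q : ℝ × X => (q.1, extChartAt 𝓘(ℝ, E) p q.2)) (t, x) :=
        contMDiffAt_fst.prodMk_space
          ((contMDiffAt_extChartAt' hx.1).comp (t, x) contMDiffAt_snd)
      exact ContMDiffAt.comp (t, x) h2 h3
    refine h1.congr_of_eventuallyEq ?_
    filter_upwards [(hW.preimage continuous_snd).mem_nhds hx] with q hq
    obtain ⟨hq₁, hq₂⟩ : q.2 ∈ (chartAt E p).source ∧ extChartAt 𝓘(ℝ, E) p q.2 ∈ V := hq
    ext v
    simp only [ContinuousLinearMap.comp_apply]
    rw [glueFun_of_mem J (Θ q.1) hq₁ hq₂]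
    simp only [ContinuousLinearMap.comp_apply, toCoord_ofCoord hq₁]
  · have hxK : x ∈ ((extChartAt 𝓘(ℝ, E) p).symm '' K)ᶜ := by
      rintro ⟨y, hy, rfl⟩
      refine hx ⟨?_, ?_⟩
      · simpa using (extChartAt 𝓘(ℝ, E) p).map_target (hVt (hKV hy))
      · rw [Set.mem_preimage, (extChartAt 𝓘(ℝ, E) p).right_inv (hVt (hKV hy))]
        exact hKV hy
    refine (J.smooth.contMDiffAt.comp (t, x) contMDiffAt_snd).congr_of_eventuallyEq ?_
    filter_upwards [(hKX.isOpen_compl.preimage continuous_snd).mem_nhds hxK] with q hq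
    simp only [Function.comp_def]
    congr 1
    refine glueFun_eq J fun h1 h2 => hΘ _ _ ⟨h2, fun h3 => hq ⟨_, h3, ?_⟩⟩
    exact (extChartAt 𝓘(ℝ, E) p).left_inv (by simpa using h1)

end Gluing

/-! ### Injective differentials give immersions -/

section Immersion

variable {E : Type*} [NormedAddCommGroup E] [NormedSpace ℝ E] [CompleteSpace E]
  {E' : Type*} [NormedAddCommGroup E'] [NormedSpace ℝ E']
  {F : Type*} [NormedAddCommGroup F] [NormedSpace ℝ F]

/-- A smooth map with injective differential is, in suitable coordinates of the target, a linear
inclusion. -/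
theorem exists_straightening {G : E' → E} {O : Set E'} (hO : IsOpen O) (hG : ContDiffOn ℝ ∞ G O)
    {u₀ : E'} (hu₀ : u₀ ∈ O) (L : (E' × F) ≃L[ℝ] E) (hL : ∀ u, L (u, 0) = fderiv ℝ G u₀ u) :
    ∃ h : OpenPartialHomeomorph E E, L (u₀, 0) ∈ h.source ∧ ContDiffOn ℝ ∞ h h.source ∧
      ContDiffOn ℝ ∞ h.symm h.target ∧
      ∀ u, L (u, 0) ∈ h.source → u ∈ O ∧ h (L (u, 0)) = G u := by
  -- `G` is extended linearly in the complementary directions; by `hL` the differential of `Ψ` at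
  -- the base point is the identity.
  let Ψ : E → E := fun y => G (L.symm y).1 + L (0, (L.symm y).2)
  let O' : Set E := {y | (L.symm y).1 ∈ O}
  have hO' : IsOpen O' := hO.preimage (continuous_fst.comp L.symm.continuous)
  have hΨ : ContDiffOn ℝ ∞ Ψ O' := by
    refine ContDiffOn.add (hG.comp (contDiff_fst.comp L.symm.contDiff).contDiffOn fun y hy => hy) ?_
    exact (L.contDiff.comp (contDiff_const.prodMk
      (contDiff_snd.comp L.symm.contDiff))).contDiffOn
  have ha : L (u₀, 0) ∈ O' := by simpa [O'] using hu₀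
  have hd : HasFDerivAt Ψ ((ContinuousLinearEquiv.refl ℝ E : E ≃L[ℝ] E) : E →L[ℝ] E)
      (L (u₀, 0)) := by
    have h1 : HasFDerivAt G (fderiv ℝ G u₀) (L.symm (L (u₀, 0))).1 := by
      rw [L.symm_apply_apply]
      exact ((hG.contDiffAt (hO.mem_nhds hu₀)).differentiableAt (by simp)).hasFDerivAt
    have h2 : HasFDerivAt (fun y : E => (L.symm y).1)
        ((ContinuousLinearMap.fst ℝ E' F).comp (L.symm : E →L[ℝ] E' × F)) (L (u₀, 0)) :=
      ((ContinuousLinearMap.fst ℝ E' F).comp (L.symm : E →L[ℝ] E' × F)).hasFDerivAt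
    have h3 : HasFDerivAt (fun y : E => L (0, (L.symm y).2))
        ((L : E' × F →L[ℝ] E).comp ((ContinuousLinearMap.inr ℝ E' F).comp
          ((ContinuousLinearMap.snd ℝ E' F).comp (L.symm : E →L[ℝ] E' × F)))) (L (u₀, 0)) :=
      ((L : E' × F →L[ℝ] E).comp ((ContinuousLinearMap.inr ℝ E' F).comp
          ((ContinuousLinearMap.snd ℝ E' F).comp (L.symm : E →L[ℝ] E' × F)))).hasFDerivAt
    refine ((h1.comp (L (u₀, 0)) (f := fun y : E => (L.symm y).1) h2).add h3).congr_fderiv ?_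
    ext v
    simp [← hL, ← map_add]
  have hΨa : ContDiffAt ℝ ∞ Ψ (L (u₀, 0)) := hΨ.contDiffAt (hO'.mem_nhds ha)
  let h₀ := hΨa.toOpenPartialHomeomorph Ψ hd (by simp)
  -- Invertibility of the differential at every point of the source, not only the base point, makes
  -- the inverse smooth on the whole target.
  let B : Set E := O' ∩ {y | IsUnit (fderiv ℝ Ψ y)}
  have hB : IsOpen B :=
    (hΨ.continuousOn_fderiv_of_isOpen hO' (by simp)).isOpen_inter_preimage hO'
      (Units.isOpen (R := E →L[ℝ] E))
  let h := h₀.restrOpen B hB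
  have hsub : h.source ⊆ O' := fun y hy => hy.2.1
  refine ⟨h, ⟨hΨa.mem_toOpenPartialHomeomorph_source hd (by simp), ha, ?_⟩, hΨ.mono hsub, ?_, ?_⟩
  · change IsUnit (fderiv ℝ Ψ (L (u₀, 0)))
    rw [hd.fderiv]
    exact isUnit_one
  · intro y hy
    have hy' : h.symm y ∈ h.source := h.map_target hy
    obtain ⟨T, hT⟩ := hy'.2.2
    have hΨy : ContDiffAt ℝ ∞ Ψ (h.symm y) := hΨ.contDiffAt (hO'.mem_nhds (hsub hy'))
    refine (h.contDiffAt_symm (f₀' := ContinuousLinearEquiv.ofUnit T) hy ?_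
      hΨy).contDiffWithinAt
    have : ((ContinuousLinearEquiv.ofUnit T : E ≃L[ℝ] E) : E →L[ℝ] E) = fderiv ℝ Ψ (h.symm y) := by
      rw [← hT]; rfl
    rw [this]
    exact (hΨy.differentiableAt (by simp)).hasFDerivAt
  · intro u hu
    have := hsub hu
    simp only [O', Set.mem_ofPred_eq, L.symm_apply_apply] at this
    refine ⟨this, ?_⟩
    change Ψ (L (u, 0)) = G u
    simp [Ψ]

variable {X : Type*} [TopologicalSpace X] [ChartedSpace E X] [IsManifold 𝓘(ℝ, E) ∞ X]
  {H' : Type*} [TopologicalSpace H'] {I' : ModelWithCorners ℝ E' H'} [I'.Boundaryless]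
  {N : Type*} [TopologicalSpace N] [ChartedSpace H' N] [IsManifold I' ∞ N]

/-- The straightening diffeomorphism is absorbed into the target chart, and the source chart is
shrunk to where it applies. -/
theorem isImmersionAtOfComplement_of_equiv {f : N → X} (hf : ContMDiff I' 𝓘(ℝ, E) ∞ f) {z : N}
    (L : (E' × F) ≃L[ℝ] E) (hL : ∀ u : E', L (u, 0) = mfderiv I' 𝓘(ℝ, E) f z u) :
    Manifold.IsImmersionAtOfComplement F I' 𝓘(ℝ, E) ∞ f z := by
  let G : E' → E := extChartAt 𝓘(ℝ, E) (f z) ∘ f ∘ (extChartAt I' z).symm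
  let O : Set E' := (extChartAt I' z).target ∩
    (extChartAt I' z).symm ⁻¹' (f ⁻¹' (extChartAt 𝓘(ℝ, E) (f z)).source)
  have hO : IsOpen O := (continuousOn_extChartAt_symm z).isOpen_inter_preimage
    (isOpen_extChartAt_target z) ((isOpen_extChartAt_source (f z)).preimage hf.continuous)
  have hG : ContDiffOn ℝ ∞ G O := (contMDiff_iff.1 hf).2 z (f z)
  have hu₀ : extChartAt I' z z ∈ O :=
    ⟨mem_extChartAt_target z, by simp⟩
  have hL' : ∀ u, L (u, 0) = fderiv ℝ G (extChartAt I' z z) u := by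
    intro u
    rw [hL, (hf.mdifferentiable (by simp) z).mfderiv, I'.range_eq_univ, fderivWithin_univ]
    rfl
  obtain ⟨h, hmem, hh, hhs, hhG⟩ := exists_straightening hO hG hu₀ L hL'
  let S : Set N := (extChartAt I' z).source ∩ extChartAt I' z ⁻¹' {u | L (u, 0) ∈ h.source}
  have hS : IsOpen S := (continuousOn_extChartAt z).isOpen_inter_preimage
    (isOpen_extChartAt_source z)
    (h.open_source.preimage (L.continuous.comp (continuous_id.prodMk continuous_const)))
  have hfz : chartAt E (f z) (f z) = h (L (extChartAt I' z z, 0)) := by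
    rw [(hhG _ hmem).2]
    simp [G]
  refine Manifold.IsImmersionAtOfComplement.mk_of_continuousAt hf.continuous.continuousAt L
    ((chartAt H' z).restr S) ((chartAt E (f z)).trans h.symm) ?_ ?_ ?_ ?_ ?_
  · rw [(chartAt H' z).restr_source' S hS]
    exact ⟨mem_chart_source H' z, mem_extChartAt_source z, hmem⟩
  · rw [OpenPartialHomeomorph.trans_source]
    refine ⟨mem_chart_source E (f z), ?_⟩
    rw [Set.mem_preimage, hfz]
    exact h.map_source hmem
  · exact restr_mem_maximalAtlas _ (IsManifold.chart_mem_maximalAtlas z) hS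
  · refine OpenPartialHomeomorph.mem_maximalAtlas_of_contMDiffOn
      ((chartAt E (f z)).trans h.symm) ?_ ?_
    · exact hhs.contMDiffOn.comp ((contMDiffOn_chart (I := 𝓘(ℝ, E)) (x := f z)).mono
        (fun x hx => hx.1)) fun x hx => hx.2
    · exact (contMDiffOn_chart_symm (I := 𝓘(ℝ, E)) (x := f z)).comp
        (hh.contMDiffOn.mono fun x hx => hx.1) fun x hx => hx.2
  · intro u hu
    have hu' : (chartAt H' z).symm (I'.symm u) ∈ ((chartAt H' z).restr S).source := by
      have := (((chartAt H' z).restr S).extend I').map_target hu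
      rw [OpenPartialHomeomorph.extend_source] at this
      exact this
    rw [(chartAt H' z).restr_source' S hS] at hu'
    have hut : u ∈ (extChartAt I' z).target := by
      have := hu
      simp only [OpenPartialHomeomorph.extend, mfld_simps] at this ⊢
      tauto
    have hr : extChartAt I' z ((chartAt H' z).symm (I'.symm u)) = u :=
      (extChartAt I' z).right_inv hut
    have hLu : L (u, 0) ∈ h.source := by
      have := hu'.2.2
      rwa [Set.mem_preimage, hr] at this
    have key := hhG u hLu
    change h.symm (G u) = L (u, 0)
    rw [← key.2, h.left_inv hLu]

/-- A smooth map into a finite-dimensional manifold with injective differentials is an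
immersion. -/
theorem isImmersion_of_injective_mfderiv [FiniteDimensional ℝ E] {f : N → X}
    (hf : ContMDiff I' 𝓘(ℝ, E) ∞ f)
    (hinj : ∀ z, Function.Injective (mfderiv I' 𝓘(ℝ, E) f z)) :
    Manifold.IsImmersion I' 𝓘(ℝ, E) ∞ f := by
  rcases isEmpty_or_nonempty N with hN | ⟨⟨z₀⟩⟩
  · exact ⟨E, inferInstance, inferInstance, fun z => (hN.false z).elim⟩
  let D : N → E' →ₗ[ℝ] E := fun z => (mfderiv I' 𝓘(ℝ, E) f z).toLinearMap
  have hD : ∀ z, Function.Injective (D z) := hinj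
  have : FiniteDimensional ℝ E' := FiniteDimensional.of_injective (D z₀) (hD z₀)
  -- An immersion uses a single complement for all points. The complements of the ranges all have
  -- the same dimension, so each is identified with `C z₀`.
  choose C hC using fun z => (LinearMap.range (D z)).exists_isCompl
  have hdim : ∀ z, Module.finrank ℝ (C z) + Module.finrank ℝ E' = Module.finrank ℝ E := fun z => by
    rw [← Submodule.finrank_add_eq_of_isCompl (hC z), add_comm, LinearMap.finrank_range_of_inj (hD z)]
  refine ⟨C z₀, inferInstance, inferInstance, fun z => ?_⟩
  let e : C z₀ ≃ₗ[ℝ] C z := LinearEquiv.ofFinrankEq _ _ (by have := hdim z; have := hdim z₀; omega)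
  let L : (E' × C z₀) ≃ₗ[ℝ] E :=
    ((LinearEquiv.ofInjective (D z) (hD z)).prodCongr e).trans
      (Submodule.prodEquivOfIsCompl _ _ (hC z))
  refine isImmersionAtOfComplement_of_equiv hf L.toContinuousLinearEquiv fun u => ?_
  simp [L]
  rfl

end Immersion

/-! ### Almost complex structures induced along an immersion -/

section Induced

variable {E' : Type*} [NormedAddCommGroup E'] [NormedSpace ℝ E'] [FiniteDimensional ℝ E']
  {H' : Type*} [TopologicalSpace H'] {I' : ModelWithCorners ℝ E' H'}
  {N : Type*} [TopologicalSpace N] [ChartedSpace H' N] [IsManifold I' ∞ N]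
  {W : Type*} [NormedAddCommGroup W] [NormedSpace ℝ W] [FiniteDimensional ℝ W]

/-- If a smooth field `T` of endomorphisms of `W` along an immersion `F : N → W` preserves the
tangent spaces and squares to `-1` on them, then it induces an almost complex structure on `N`. -/
theorem exists_induced_almostComplexStructure {F : N → W} (hF : ContMDiff I' 𝓘(ℝ, W) ∞ F)
    {D : ∀ z : N, TangentSpace I' z →L[ℝ] W} (hD : ∀ z, D z = mfderiv I' 𝓘(ℝ, W) F z)
    (hinj : ∀ z, Function.Injective (D z))
    {T : N → W →L[ℝ] W} (hT : ContMDiff I' 𝓘(ℝ, W →L[ℝ] W) ∞ T)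
    (hTD : ∀ z v, ∃ v', D z v' = T z (D z v)) (hsq : ∀ z v, T z (T z (D z v)) = -D z v) :
    ∃ j : AlmostComplexStructure I' N, ∀ z v, D z (j.toFun z v) = T z (D z v) := by
  -- These left inverses are chosen pointwise with no regularity in `z`; smoothness of `j` is
  -- obtained separately below.
  have hleft : ∀ z, ∃ Λ : W →L[ℝ] TangentSpace I' z, ∀ v, Λ (D z v) = v := by
    intro z
    obtain ⟨Λ, hΛ⟩ := (D z).toLinearMap.exists_leftInverse_of_injective
      (LinearMap.ker_eq_bot.2 (hinj z))
    exact ⟨LinearMap.toContinuousLinearMap Λ, fun v => LinearMap.congr_fun hΛ v⟩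
  choose Λ hΛ using hleft
  let j : ∀ z : N, TangentSpace I' z →L[ℝ] TangentSpace I' z := fun z =>
    (Λ z).comp ((T z).comp (D z))
  have hj : ∀ z v, D z (j z v) = T z (D z v) := by
    intro z v
    obtain ⟨v', hv'⟩ := hTD z v
    simp only [j, ContinuousLinearMap.comp_apply, ← hv', hΛ]
  refine ⟨⟨j, fun z v => hinj z ?_, fun z₀ => ?_⟩, hj⟩
  · rw [hj, hj, hsq, map_neg]
  let e := trivializationAt E' (TangentSpace I') z₀
  have hbase : ∀ z ∈ e.baseSet, ∀ v, e.symmL ℝ z (e.continuousLinearMapAt ℝ z v) = v :=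
    fun z hz v => e.symmL_continuousLinearMapAt hz v
  have hbase' : ∀ z ∈ e.baseSet, ∀ v, e.continuousLinearMapAt ℝ z (e.symmL ℝ z v) = v :=
    fun z hz v => e.continuousLinearMapAt_symmL hz v
  have hz₀ : z₀ ∈ e.baseSet := FiberBundle.mem_baseSet_trivializationAt' z₀
  let d : N → E' →L[ℝ] W := fun z => (D z).comp (e.symmL ℝ z)
  have hd : ContMDiffAt I' 𝓘(ℝ, E' →L[ℝ] W) ∞ d z₀ := by
    have h := hF.contMDiffAt.mfderiv_const (x₀ := z₀) (m := ∞) (by simp)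
    refine h.congr_of_eventuallyEq (Filter.Eventually.of_forall fun z => ?_)
    simp only [inTangentCoordinates, ContinuousLinearMap.inCoordinates, d, hD, id,
      TangentBundle.continuousLinearMapAt_model_space]
    rfl
  have hdinj : Function.Injective (d z₀) := by
    intro v w h
    have := congrArg (e.continuousLinearMapAt ℝ z₀) (hinj z₀ h)
    exact (hbase' z₀ hz₀ v).symm.trans (this.trans (hbase' z₀ hz₀ w))
  -- One fixed left inverse at `z₀` suffices nearby: `B = Γ d` is `1` at `z₀`, hence invertible near
  -- it, and `j` reads `B⁻¹ Γ T d` in coordinates, a smooth expression.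
  obtain ⟨Γ, hΓ⟩ : ∃ Γ : W →L[ℝ] E', ∀ v, Γ (d z₀ v) = v := by
    obtain ⟨Γ, hΓ⟩ := (d z₀).toLinearMap.exists_leftInverse_of_injective
      (LinearMap.ker_eq_bot.2 hdinj)
    exact ⟨LinearMap.toContinuousLinearMap Γ, fun v => LinearMap.congr_fun hΓ v⟩
  let B : N → E' →L[ℝ] E' := fun z => Γ.comp (d z)
  have hB : ContMDiffAt I' 𝓘(ℝ, E' →L[ℝ] E') ∞ B z₀ := contMDiffAt_const.clm_comp hd
  have hB₀ : B z₀ = 1 := ContinuousLinearMap.ext hΓ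
  have hBinv : ContMDiffAt I' 𝓘(ℝ, E' →L[ℝ] E') ∞ (fun z => Ring.inverse (B z)) z₀ := by
    have h := (contDiffAt_ringInverse ℝ (n := ∞) (1 : (E' →L[ℝ] E')ˣ)).contMDiffAt
    rw [Units.val_one, ← hB₀] at h
    exact h.comp z₀ hB
  have hBu : ∀ᶠ z in 𝓝 z₀, IsUnit (B z) := by
    refine hB.continuousAt.eventually (p := fun A => IsUnit A) ?_
    rw [hB₀]
    exact Units.isOpen.mem_nhds isUnit_one
  refine (contMDiffAt_hom_bundle _).2 ⟨contMDiffAt_id, ?_⟩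
  refine (hBinv.clm_comp (contMDiffAt_const (c := Γ) |>.clm_comp
    (hT.contMDiffAt.clm_comp hd))).congr_of_eventuallyEq ?_
  filter_upwards [hBu, e.open_baseSet.mem_nhds hz₀] with z hz hzb
  change (e.continuousLinearMapAt ℝ z).comp ((j z).comp (e.symmL ℝ z)) =
    (Ring.inverse (B z)).comp (Γ.comp ((T z).comp (d z)))
  have key : Γ.comp ((T z).comp (d z)) =
      (B z).comp ((e.continuousLinearMapAt ℝ z).comp ((j z).comp (e.symmL ℝ z))) := by
    ext v
    simp only [B, d, ContinuousLinearMap.comp_apply, hbase z hzb, hj]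
  rw [key]
  change _ = Ring.inverse (B z) * (B z * _)
  rw [← mul_assoc, Ring.inverse_mul_cancel _ hz, one_mul]

end Induced

/-! ### The flat torus and its complex structure -/

section Torus

attribute [local instance] finrank_real_complex_fact'

theorem contMDiff_circle_coe : ContMDiff (𝓡 1) 𝓘(ℝ, ℂ) ∞ (fun z : Circle => (z : ℂ)) :=
  contMDiff_coe_sphere (E := ℂ) (n := 1)

/-- The differential of the inclusion of the unit circle in `ℂ`. -/
noncomputable def circleDeriv (z : Circle) : TangentSpace (𝓡 1) z →L[ℝ] ℂ :=
  mvfderiv (𝓡 1) (fun z : Circle => (z : ℂ)) z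

theorem hasMFDerivAt_circle_coe (z : Circle) :
    HasMFDerivAt (𝓡 1) 𝓘(ℝ, ℂ) (fun z : Circle => (z : ℂ)) z (circleDeriv z) :=
  (contMDiff_circle_coe.mdifferentiableAt (by simp)).hasMFDerivAt

theorem injective_circleDeriv (z : Circle) : Function.Injective (circleDeriv z) :=
  injective_mvfderiv_subtypeVal_sphere (E := ℂ) (n := 1) z

/-- The tangent line to the circle at `z` is `i z ℝ`. -/
theorem exists_circleDeriv_eq_iff (z : Circle) (w : ℂ) :
    (∃ v, circleDeriv z v = w) ↔ ∃ a : ℝ, w = a * Complex.I * z := by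
  have h : (circleDeriv z).range = (Submodule.span ℝ {(z : ℂ)})ᗮ :=
    range_mvfderiv_subtypeVal (E := ℂ) (n := 1) z
  have h1 : (∃ v, circleDeriv z v = w) ↔ w ∈ (circleDeriv z).range := Iff.rfl
  have hz : starRingEnd ℂ (z : ℂ) * z = 1 := by
    rw [Complex.conj_mul', Circle.norm_coe]; norm_num
  rw [h1, h, Submodule.mem_orthogonal_singleton_iff_inner_right, Complex.inner]
  constructor
  · intro h0
    refine ⟨(w * starRingEnd ℂ (z : ℂ)).im, ?_⟩
    have h2 := Complex.re_add_im (w * starRingEnd ℂ (z : ℂ))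
    rw [h0, Complex.ofReal_zero, zero_add] at h2
    rw [h2]
    linear_combination -w * hz
  · rintro ⟨a, rfl⟩
    have h2 : a * Complex.I * z * starRingEnd ℂ (z : ℂ) = a * Complex.I := by
      linear_combination a * Complex.I * hz
    refine (congrArg Complex.re h2).trans ?_
    simp

/-- The standard inclusion of the torus in `ℂ × ℂ`. -/
noncomputable def torusIncl (z : Torus) : ℂ × ℂ := ((z.1 : ℂ), (z.2 : ℂ))

theorem contMDiff_torusIncl : ContMDiff ((𝓡 1).prod (𝓡 1)) 𝓘(ℝ, ℂ × ℂ) ∞ torusIncl :=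
  (contMDiff_circle_coe.comp contMDiff_fst).prodMk_space (contMDiff_circle_coe.comp contMDiff_snd)

/-- The differential of `torusIncl`. -/
noncomputable def torusDeriv (z : Torus) : TangentSpace ((𝓡 1).prod (𝓡 1)) z →L[ℝ] ℂ × ℂ :=
  (circleDeriv z.1).prodMap (circleDeriv z.2)

theorem hasMFDerivAt_torusIncl (z : Torus) :
    HasMFDerivAt ((𝓡 1).prod (𝓡 1)) 𝓘(ℝ, ℂ × ℂ) torusIncl z (torusDeriv z) := by
  rw [modelWithCornersSelf_prod, ← chartedSpaceSelf_prod]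
  exact ((hasMFDerivAt_circle_coe z.1).comp z (hasMFDerivAt_fst z)).prodMk
    ((hasMFDerivAt_circle_coe z.2).comp z (hasMFDerivAt_snd z))

theorem injective_torusDeriv (z : Torus) : Function.Injective (torusDeriv z) :=
  (injective_circleDeriv z.1).prodMap (injective_circleDeriv z.2)

theorem exists_torusDeriv_eq_iff (z : Torus) (w : ℂ × ℂ) :
    (∃ v, torusDeriv z v = w) ↔
      ∃ a b : ℝ, w = (a * Complex.I * z.1, b * Complex.I * z.2) := by
  constructor
  · rintro ⟨v, rfl⟩
    obtain ⟨a, ha⟩ := (exists_circleDeriv_eq_iff z.1 _).1 ⟨v.1, rfl⟩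
    obtain ⟨b, hb⟩ := (exists_circleDeriv_eq_iff z.2 _).1 ⟨v.2, rfl⟩
    exact ⟨a, b, Prod.ext ha hb⟩
  · rintro ⟨a, b, rfl⟩
    obtain ⟨v, hv⟩ := (exists_circleDeriv_eq_iff z.1 _).2 ⟨a, rfl⟩
    obtain ⟨v', hv'⟩ := (exists_circleDeriv_eq_iff z.2 _).2 ⟨b, rfl⟩
    exact ⟨(v, v'), Prod.ext hv hv'⟩

/-- The complex structure `(w₁, w₂) ↦ c (conj w₂, -conj w₁)` of `ℂ × ℂ`, for `|c| = 1`. -/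
noncomputable def twistedQuatJ (c : ℂ) : ℂ × ℂ →L[ℝ] ℂ × ℂ :=
  ((c • ContinuousLinearMap.id ℂ (ℂ × ℂ)).restrictScalars ℝ).comp quatJ

theorem twistedQuatJ_apply (c : ℂ) (w : ℂ × ℂ) :
    twistedQuatJ c w = (c * starRingEnd ℂ w.2, -(c * starRingEnd ℂ w.1)) := by
  rw [← mul_neg]
  rfl

/-- On the unit circle conjugation is inversion, so the factor `z₁ z₂` turns the conjugate of `z₂`
into `z₁` and that of `z₁` into `z₂`. In the frame `(i z₁, i z₂)` the result is rotation by a right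
angle. -/
theorem twistedQuatJ_tangent (z : Torus) (a b : ℝ) :
    twistedQuatJ (z.1 * z.2) (a * Complex.I * z.1, b * Complex.I * z.2) =
      ((-b : ℝ) * Complex.I * z.1, a * Complex.I * z.2) := by
  have h1 : starRingEnd ℂ (z.1 : ℂ) * z.1 = 1 := by
    rw [Complex.conj_mul', Circle.norm_coe]; norm_num
  have h2 : starRingEnd ℂ (z.2 : ℂ) * z.2 = 1 := by
    rw [Complex.conj_mul', Circle.norm_coe]; norm_num
  rw [twistedQuatJ_apply]
  simp only [map_mul, Complex.conj_ofReal, Complex.conj_I, Complex.ofReal_neg]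
  ext1
  · linear_combination -(b * Complex.I * z.1) * h2
  · linear_combination (a * Complex.I * z.2) * h1

/-- The almost complex structure on the torus that rotates the two circle directions into each
other. -/
theorem exists_torus_almostComplexStructure :
    ∃ j : AlmostComplexStructure ((𝓡 1).prod (𝓡 1)) Torus, ∀ z v,
      torusDeriv z (j.toFun z v) = twistedQuatJ (z.1 * z.2) (torusDeriv z v) := by
  refine exists_induced_almostComplexStructure contMDiff_torusIncl
    (fun z => (hasMFDerivAt_torusIncl z).mfderiv.symm) injective_torusDeriv
    (T := fun z => twistedQuatJ (z.1 * z.2)) ?_ ?_ ?_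
  · have h : ContMDiff ((𝓡 1).prod (𝓡 1)) 𝓘(ℝ, ℂ) ∞ fun z : Torus => (z.1 : ℂ) * z.2 :=
      (contDiff_mul (𝕜 := ℝ) (𝔸 := ℂ)).contMDiff.comp contMDiff_torusIncl
    have h' : ContDiff ℝ ∞ twistedQuatJ := by
      have : twistedQuatJ = fun c : ℂ => c.re • quatJ + c.im • mulI.comp quatJ := by
        funext c
        refine ContinuousLinearMap.ext fun w => ?_
        have hc := Complex.re_add_im c
        rw [twistedQuatJ_apply]
        simp only [add_apply, smul_apply, ContinuousLinearMap.comp_apply, mulI_apply, quatJ_apply]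
        ext1
        · simp only [Prod.fst_add, Prod.smul_fst, Complex.real_smul]
          linear_combination -starRingEnd ℂ w.2 * hc
        · simp only [Prod.snd_add, Prod.smul_snd, Complex.real_smul]
          linear_combination starRingEnd ℂ w.1 * hc
      rw [this]
      exact (Complex.reCLM.contDiff.smul contDiff_const).add
        (Complex.imCLM.contDiff.smul contDiff_const)
    exact h'.contMDiff.comp h
  · intro z v
    obtain ⟨a, b, hab⟩ := (exists_torusDeriv_eq_iff z _).1 ⟨v, rfl⟩
    rw [hab, twistedQuatJ_tangent]
    exact (exists_torusDeriv_eq_iff z _).2 ⟨-b, a, rfl⟩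
  · intro z v
    obtain ⟨a, b, hab⟩ := (exists_torusDeriv_eq_iff z _).1 ⟨v, rfl⟩
    rw [hab, twistedQuatJ_tangent, twistedQuatJ_tangent]
    ext1 <;> simp

end Torus

/-! ### Stokes on the cone over the torus -/

section Stokes

/-- The function `x ↦ x₀ exp (i xₖ)` on `ℝ³`. -/
noncomputable def polar (k : Fin 3) (x : Fin 3 → ℝ) : ℂ :=
  (x 0 : ℂ) * Complex.exp (x k * Complex.I)

theorem contDiff_polar (k : Fin 3) : ContDiff ℝ ∞ (polar k) := by
  have h : ∀ i : Fin 3, ContDiff ℝ ∞ fun x : Fin 3 → ℝ => (x i : ℂ) := fun i =>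
    Complex.ofRealCLM.contDiff.comp (contDiff_apply ℝ ℝ i)
  exact (h 0).mul (((h k).mul contDiff_const).cexp)

theorem fderiv_polar (k : Fin 3) (x v : Fin 3 → ℝ) :
    fderiv ℝ (polar k) x v = v 0 * Complex.exp (x k * Complex.I) +
      x 0 * (v k * Complex.I * Complex.exp (x k * Complex.I)) := by
  have h : ∀ i : Fin 3, HasFDerivAt (fun x : Fin 3 → ℝ => (x i : ℂ))
      (Complex.ofRealCLM.comp (ContinuousLinearMap.proj (R := ℝ) (φ := fun _ : Fin 3 => ℝ) i)) x :=
    fun i => (Complex.ofRealCLM.comp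
      (ContinuousLinearMap.proj (R := ℝ) (φ := fun _ : Fin 3 => ℝ) i)).hasFDerivAt
  have h2 := (h 0).mul ((h k).mul_const Complex.I).cexp
  have h3 : fderiv ℝ (polar k) x = _ := h2.fderiv
  rw [h3]
  simp
  ring

theorem norm_polar_le {x : Fin 3 → ℝ} (h0 : 0 ≤ x 0) (h1 : x 0 ≤ 1) (k : Fin 3) :
    ‖polar k x‖ ≤ 1 := by
  rw [polar, norm_mul, Complex.norm_exp_ofReal_mul_I, mul_one, Complex.norm_real,
    Real.norm_of_nonneg h0]
  exact h1

theorem polar_add_period (k : Fin 3) {i : Fin 3} (hi : i ≠ 0) (x : Fin 3 → ℝ) :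
    polar k (x + Pi.single i (2 * Real.pi)) = polar k x := by
  have h0 : (x + Pi.single i (2 * Real.pi) : Fin 3 → ℝ) 0 = x 0 := by simp [hi.symm]
  rw [polar, polar, h0]
  rcases eq_or_ne k i with rfl | hk
  · simp only [Pi.add_apply, Pi.single_eq_same]
    congr 1
    push_cast
    rw [add_mul, Complex.exp_add, Complex.exp_two_pi_mul_I, mul_one]
  · simp [hk]

variable {E : Type*} [NormedAddCommGroup E] [NormedSpace ℝ E]

/-- A closed 2-form on a neighbourhood of a filled flat torus cannot be positive on the tangent
planes of that torus. -/
theorem not_forall_torus_pos {α : E → E [⋀^Fin 2]→L[ℝ] ℝ} {V : Set E} (hV : IsOpen V)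
    (hα : ContDiffOn ℝ ∞ α V) (hclosed : ∀ y ∈ V, extDeriv α y = 0) {y₀ : E}
    (τ : ℂ × ℂ →L[ℝ] E) (hτ : ∀ z, ‖z‖ ≤ 1 → y₀ + τ z ∈ V) :
    ¬ ∀ z : Torus, 0 < α (y₀ + τ (torusIncl z))
      ![τ (Complex.I * z.1, 0), τ (0, Complex.I * z.2)] := by
  intro hpos
  -- The cone over the torus in coordinates `(r, θ₁, θ₂)`, on the box `[0, 1] × [0, 2π]²`.
  let F : (Fin 3 → ℝ) → E := fun x => y₀ + τ (polar 1 x, polar 2 x)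
  have hF : ContDiff ℝ ∞ F := contDiff_const.add
    (τ.contDiff.comp ((contDiff_polar 1).prodMk (contDiff_polar 2)))
  have hFd : ∀ x v, fderiv ℝ F x v = τ (fderiv ℝ (polar 1) x v, fderiv ℝ (polar 2) x v) := by
    intro x v
    have h1 := ((contDiff_polar 1).differentiable (by simp) x).hasFDerivAt
    have h2 := ((contDiff_polar 2).differentiable (by simp) x).hasFDerivAt
    have h3 : HasFDerivAt F _ x := (τ.hasFDerivAt.comp x (h1.prodMk h2)).const_add y₀
    rw [h3.fderiv]
    rfl
  let η : (Fin 3 → ℝ) → (Fin 3 → ℝ) [⋀^Fin 2]→L[ℝ] ℝ := fun x =>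
    (α (F x)).compContinuousLinearMap (fderiv ℝ F x)
  let e : Fin 3 → Fin 3 → ℝ := fun i => Pi.single i 1
  let a : Fin 3 → ℝ := 0
  let b : Fin 3 → ℝ := ![1, 2 * Real.pi, 2 * Real.pi]
  have hπ := Real.pi_pos
  have hab : a ≤ b := by
    intro i
    fin_cases i <;> simp [a, b, hπ.le]
  have hFV : ∀ x ∈ Set.Icc a b, F x ∈ V := by
    intro x hx
    have h0 : 0 ≤ x 0 := hx.1 0
    have h1 : x 0 ≤ 1 := hx.2 0
    exact hτ _ (max_le (norm_polar_le h0 h1 1) (norm_polar_le h0 h1 2))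
  have hαF : ∀ x, F x ∈ V → ContDiffAt ℝ ∞ α (F x) := fun x hx =>
    hα.contDiffAt (hV.mem_nhds hx)
  -- Signed components of the pulled-back form: their divergence is its exterior derivative on the
  -- standard basis, so Stokes becomes the divergence theorem on a box.
  let f : Fin 3 → (Fin 3 → ℝ) → ℝ := fun i x =>
    (-1 : ℝ) ^ i.val * η x (i.removeNth e)
  have hη : ∀ x, F x ∈ V → DifferentiableAt ℝ η x := by
    intro x hx
    refine DifferentiableAt.continuousAlternatingMapCompContinuousLinearMap ?_ ?_
    · exact ((hαF x hx).differentiableAt (by simp)).comp x (hF.differentiable (by simp) x)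
    · exact (hF.fderiv_right (m := ∞) (by simp)).differentiable (by simp) x
  have hfi : ∀ i x, F x ∈ V → DifferentiableAt ℝ (f i) x := fun i x hx =>
    ((hη x hx).continuousAlternatingMap_apply_const (i.removeNth e)).const_mul _
  have hdiv : ∀ x, F x ∈ V → ∑ i, fderiv ℝ (f i) x (e i) = 0 := by
    intro x hx
    have h1 : extDeriv η x = 0 := by
      have := extDeriv_pullback (f := F) (x := x) (r := ∞)
        ((hαF x hx).differentiableAt (by simp)) hF.contDiffAt (by
          rw [minSmoothness_of_isRCLikeNormedField]
          exact WithTop.coe_le_coe.2 (le_top : (2 : ℕ∞) ≤ ⊤))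
      rw [hclosed _ hx] at this
      exact this
    have h2 := extDeriv_apply (hη x hx) e
    rw [h1] at h2
    rw [← show (0 : ℝ) = ∑ i, fderiv ℝ (f i) x (e i) from
      h2.trans (Finset.sum_congr rfl fun i _ => ?_)]
    simp only [f]
    rw [fderiv_const_mul ((hη x hx).continuousAlternatingMap_apply_const _)]
    simp
  have hperiod : ∀ i : Fin 3, i ≠ 0 → ∀ x, η (x + Pi.single i (2 * Real.pi)) = η x := by
    intro i hi x
    have hFp : ∀ x, F (x + Pi.single i (2 * Real.pi)) = F x := fun x => by
      simp only [F, polar_add_period _ hi]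
    have hFp' : fderiv ℝ F (x + Pi.single i (2 * Real.pi)) = fderiv ℝ F x := by
      rw [← fderiv_comp_add_right, show (fun x => F (x + Pi.single i (2 * Real.pi))) = F from
        funext hFp]
    simp only [η, hFp, hFp']
  have hf0 : ∀ y : Fin 3 → ℝ, f 0 y = α (F y)
      ![τ (y 0 * (Complex.I * Complex.exp (y 1 * Complex.I)), 0),
        τ (0, y 0 * (Complex.I * Complex.exp (y 2 * Complex.I)))] := by
    intro y
    simp only [f, η, Fin.val_zero, pow_zero, one_mul,
      ContinuousAlternatingMap.compContinuousLinearMap_apply]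
    congr 1
    funext k
    fin_cases k
    · change fderiv ℝ F y (e 1) = τ _
      simp [hFd, e, fderiv_polar]
    · change fderiv ℝ F y (e 2) = τ _
      simp [hFd, e, fderiv_polar]
  have key := MeasureTheory.integral_divergence_of_hasFDerivAt_off_countable' a b hab f
    (fun i x => fderiv ℝ (f i) x) ∅ Set.countable_empty
    (fun i x hx => (hfi i x (hFV x hx)).continuousAt.continuousWithinAt)
    (fun x hx i => (hfi i x (hFV x ⟨fun k => (hx.1 k trivial).1.le,
      fun k => (hx.1 k trivial).2.le⟩)).hasFDerivAt)
    (MeasureTheory.integrableOn_zero.congr_fun (fun x hx => (hdiv x (hFV x hx)).symm)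
      measurableSet_Icc)
  rw [MeasureTheory.setIntegral_congr_fun measurableSet_Icc fun x hx => hdiv x (hFV x hx),
    MeasureTheory.integral_zero, Fin.sum_univ_succ, Finset.sum_eq_zero, add_zero] at key
  -- At `r = 0` both angular derivatives of `F` vanish, so this face contributes nothing; the face
  -- `r = 1` is the torus itself.
  · have hback : ∀ x : Fin 2 → ℝ, f 0 ((0 : Fin 3).insertNth (a 0) x) = 0 := by
      intro x
      rw [hf0]
      refine (α _).map_coord_zero 0 ?_
      simp only [a, Fin.insertNth_apply_same, Pi.zero_apply, Complex.ofReal_zero, zero_mul]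
      exact map_zero τ
    have hfront : ∀ x : Fin 2 → ℝ, 0 < f 0 ((0 : Fin 3).insertNth (b 0) x) := by
      intro x
      rw [hf0]
      have := hpos (Circle.exp (x 0), Circle.exp (x 1))
      have hx : (Fin.cons 1 x : Fin 3 → ℝ) 2 = x 1 := rfl
      simpa [F, torusIncl, polar, b, Circle.coe_exp, hx] using this
    simp only [hback, MeasureTheory.integral_zero, sub_zero] at key
    have hcont : ContinuousOn (fun x : Fin 2 → ℝ => f 0 ((0 : Fin 3).insertNth (b 0) x))
        (Set.Icc (a ∘ (0 : Fin 3).succAbove) (b ∘ (0 : Fin 3).succAbove)) := by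
      refine ContinuousOn.comp (t := Set.Icc a b) (g := f 0)
        (f := fun x : Fin 2 → ℝ => ((0 : Fin 3).insertNth (b 0) x : Fin 3 → ℝ))
        (fun y hy => (hfi 0 y (hFV y hy)).continuousAt.continuousWithinAt) ?_ ?_
      · exact (Continuous.finInsertNth (A := fun _ : Fin 3 => ℝ) 0
          (continuous_const (y := b 0)) continuous_id).continuousOn
      · intro x hx
        rw [Fin.insertNth_mem_Icc]
        exact ⟨⟨hab 0, le_rfl⟩, hx⟩
    have hlt : (0 : ℝ) < ∫ x in Set.Icc (a ∘ (0 : Fin 3).succAbove) (b ∘ (0 : Fin 3).succAbove),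
        f 0 ((0 : Fin 3).insertNth (b 0) x) := by
      rw [MeasureTheory.setIntegral_pos_iff_support_of_nonneg_ae
        (Filter.Eventually.of_forall fun x => (hfront x).le)
        (hcont.integrableOn_compact isCompact_Icc)]
      rw [show Function.support (fun x : Fin 2 → ℝ => f 0 ((0 : Fin 3).insertNth (b 0) x)) =
        Set.univ from Set.eq_univ_of_forall fun x => (hfront x).ne', Set.univ_inter,
        Real.volume_Icc_pi]
      refine pos_iff_ne_zero.2 (Finset.prod_ne_zero_iff.2 fun i _ => ?_)
      fin_cases i <;> simp [a, b, hπ]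
    exact hlt.ne key
  -- Opposite angular faces cancel by periodicity.
  · intro i _
    have hi : i.succ ≠ 0 := Fin.succ_ne_zero i
    have hb : b i.succ = 2 * Real.pi := by fin_cases i <;> rfl
    rw [sub_eq_zero]
    congr 1
    funext x
    have : (i.succ.insertNth (b i.succ) x : Fin 3 → ℝ) =
        i.succ.insertNth (a i.succ) x + Pi.single i.succ (2 * Real.pi) := by
      funext k
      rcases Fin.eq_self_or_eq_succAbove i.succ k with rfl | ⟨l, rfl⟩
      · simp [hb, a]
      · simp
    simp only [f, this, hperiod _ hi]

end Stokes

/-! ### Null-homotopic tori are null-homologous -/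

section Homology

open CategoryTheory

universe u

/-- By homotopy invariance the induced map is that of a constant map, which factors through the
vanishing second homology of a point. -/
theorem IsNullHomologous.of_nullhomotopic {X : Type u} [TopologicalSpace X] {f : C(Torus, X)}
    {x : X} (h : f.Homotopic (ContinuousMap.const Torus x)) : IsNullHomologous f := by
  unfold IsNullHomologous
  let d : C(ULift.{u} Torus, Torus) := ⟨ULift.down, continuous_uliftDown⟩
  obtain ⟨H⟩ : (f.comp d).Homotopic ((ContinuousMap.const Torus x).comp d) := h.comp (.refl d)
  have h1 : singularH2.map (TopCat.ofHom (f.comp d)) =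
      singularH2.map (TopCat.ofHom ((ContinuousMap.const Torus x).comp d)) :=
    TopCat.Homotopy.congr_homologyMap_singularChainComplexFunctor H _ 2
  have h2 : TopCat.ofHom ((ContinuousMap.const Torus x).comp d) =
      TopCat.ofHom (ContinuousMap.const (ULift.{u} Torus) PUnit.unit.{u + 1}) ≫
        TopCat.ofHom (ContinuousMap.const PUnit.{u + 1} x) := rfl
  have h3 : Limits.IsZero (singularH2.obj (TopCat.of PUnit.{u + 1})) :=
    AlgebraicTopology.isZero_singularHomologyFunctor_of_totallyDisconnectedSpace _ 2 _ _ (by simp)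
  change singularH2.map (TopCat.ofHom (f.comp d)) = 0
  rw [h1, h2, Functor.map_comp, h3.eq_of_tgt (singularH2.map _) 0, Limits.zero_comp]

end Homology

/-! ### The torus in the manifold and the obstruction to taming -/

section Main

variable {E : Type*} [NormedAddCommGroup E] [NormedSpace ℝ E]
  {X : Type*} [TopologicalSpace X] [ChartedSpace E X] [IsManifold 𝓘(ℝ, E) ∞ X]

theorem AlmostComplexStructure.ext_toFun {J J' : AlmostComplexStructure 𝓘(ℝ, E) X}
    (h : ∀ x, J.toFun x = J'.toFun x) : J = J' := by
  cases J
  cases J'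
  congr 1
  exact funext h

/-- This reconciles the chart derivative used in `formInChart` with the bundle trivialization used
for endomorphisms. -/
theorem hasMFDerivAt_extChartAt_symm {p : X} {y : E} (hy : y ∈ (extChartAt 𝓘(ℝ, E) p).target) :
    HasMFDerivAt 𝓘(ℝ, E) 𝓘(ℝ, E) (extChartAt 𝓘(ℝ, E) p).symm y
      (ofCoord (E := E) p ((extChartAt 𝓘(ℝ, E) p).symm y)) := by
  have hx : (extChartAt 𝓘(ℝ, E) p).symm y ∈ (chartAt E p).source := by
    simpa using (extChartAt 𝓘(ℝ, E) p).map_target hy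
  have hd : MDifferentiableAt 𝓘(ℝ, E) 𝓘(ℝ, E) (extChartAt 𝓘(ℝ, E) p).symm y :=
    ((contMDiffOn_extChartAt_symm (n := ∞) p).contMDiffAt
      ((isOpen_extChartAt_target p).mem_nhds hy)).mdifferentiableAt (by simp)
  have h := TangentBundle.symmL_trivializationAt (I := 𝓘(ℝ, E)) hx
  rw [modelWithCornersSelf_coe, Set.range_id, mfderivWithin_univ,
    (extChartAt 𝓘(ℝ, E) p).right_inv hy] at h
  exact hd.hasMFDerivAt.congr_mfderiv h.symm

/-- The map of the torus to `X` that is the flat torus `y₀ + τ (z₁, z₂)` in the chart at `p`. -/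
noncomputable def chartTorus (p : X) (y₀ : E) (τ : ℂ × ℂ →L[ℝ] E) (z : Torus) : X :=
  (extChartAt 𝓘(ℝ, E) p).symm (y₀ + τ (torusIncl z))

theorem norm_torusIncl (z : Torus) : ‖torusIncl z‖ = 1 := by
  rw [torusIncl, Prod.norm_def, Circle.norm_coe, Circle.norm_coe, max_self]

variable {p : X} {y₀ : E} {τ : ℂ × ℂ →L[ℝ] E}

theorem extChartAt_chartTorus (hτ : ∀ z, ‖z‖ ≤ 1 → y₀ + τ z ∈ (extChartAt 𝓘(ℝ, E) p).target)
    (z : Torus) : extChartAt 𝓘(ℝ, E) p (chartTorus p y₀ τ z) = y₀ + τ (torusIncl z) :=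
  (extChartAt 𝓘(ℝ, E) p).right_inv (hτ _ (norm_torusIncl z).le)

theorem chartTorus_mem_source (hτ : ∀ z, ‖z‖ ≤ 1 → y₀ + τ z ∈ (extChartAt 𝓘(ℝ, E) p).target)
    (z : Torus) : chartTorus p y₀ τ z ∈ (chartAt E p).source := by
  rw [← extChartAt_source 𝓘(ℝ, E)]
  exact (extChartAt 𝓘(ℝ, E) p).map_target (hτ _ (norm_torusIncl z).le)

theorem contMDiff_chartTorus (hτ : ∀ z, ‖z‖ ≤ 1 → y₀ + τ z ∈ (extChartAt 𝓘(ℝ, E) p).target) :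
    ContMDiff ((𝓡 1).prod (𝓡 1)) 𝓘(ℝ, E) ∞ (chartTorus p y₀ τ) := by
  have h : ContDiff ℝ ∞ fun z => y₀ + τ z := contDiff_const.add τ.contDiff
  exact (contMDiffOn_extChartAt_symm p).comp_contMDiff (h.contMDiff.comp contMDiff_torusIncl)
    fun z => hτ _ (norm_torusIncl z).le

theorem hasMFDerivAt_chartTorus (hτ : ∀ z, ‖z‖ ≤ 1 → y₀ + τ z ∈ (extChartAt 𝓘(ℝ, E) p).target)
    (z : Torus) : HasMFDerivAt ((𝓡 1).prod (𝓡 1)) 𝓘(ℝ, E) (chartTorus p y₀ τ) z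
      ((ofCoord (E := E) p (chartTorus p y₀ τ z)).comp (τ.comp (torusDeriv z))) := by
  have h : HasMFDerivAt 𝓘(ℝ, ℂ × ℂ) 𝓘(ℝ, E) (fun z => y₀ + τ z) (torusIncl z) τ :=
    (τ.hasFDerivAt.const_add y₀).hasMFDerivAt
  exact (hasMFDerivAt_extChartAt_symm (hτ _ (norm_torusIncl z).le)).comp z
    (h.comp z (hasMFDerivAt_torusIncl z))

theorem injective_ofCoord {x : X} (hx : x ∈ (chartAt E p).source) :
    Function.Injective (ofCoord (E := E) p x) := fun v w h => by
  rw [← toCoord_ofCoord hx v, h, toCoord_ofCoord hx]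

/-- The topological half is automatic: an injective continuous map from a compact space to a
Hausdorff one is a closed embedding. -/
theorem isSmoothEmbedding_chartTorus [FiniteDimensional ℝ E] [T2Space X]
    (hτ : ∀ z, ‖z‖ ≤ 1 → y₀ + τ z ∈ (extChartAt 𝓘(ℝ, E) p).target)
    (hinj : Function.Injective τ) :
    Manifold.IsSmoothEmbedding ((𝓡 1).prod (𝓡 1)) 𝓘(ℝ, E) ∞ (chartTorus p y₀ τ) := by
  refine ⟨isImmersion_of_injective_mfderiv (contMDiff_chartTorus hτ) fun z => ?_, ?_⟩
  · rw [(hasMFDerivAt_chartTorus hτ z).mfderiv]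
    exact (injective_ofCoord (chartTorus_mem_source hτ z)).comp
      (hinj.comp (injective_torusDeriv z))
  · refine ((contMDiff_chartTorus hτ).continuous.isClosedEmbedding fun z w h => ?_).isEmbedding
    have h' := congrArg (extChartAt 𝓘(ℝ, E) p) h
    rw [extChartAt_chartTorus hτ, extChartAt_chartTorus hτ] at h'
    have h2 : torusIncl z = torusIncl w := hinj (add_left_cancel h')
    exact Prod.ext (Circle.ext (congrArg Prod.fst h2)) (Circle.ext (congrArg Prod.snd h2))

/-- The torus shrinks radially to the centre without leaving the bidisc. -/
theorem isNullHomologous_chartTorus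
    (hτ : ∀ z, ‖z‖ ≤ 1 → y₀ + τ z ∈ (extChartAt 𝓘(ℝ, E) p).target) :
    IsNullHomologous ⟨chartTorus p y₀ τ, (contMDiff_chartTorus hτ).continuous⟩ := by
  refine .of_nullhomotopic (x := (extChartAt 𝓘(ℝ, E) p).symm y₀) ⟨?_⟩
  have hi : Continuous torusIncl := contMDiff_torusIncl.continuous
  refine ⟨⟨fun q => (extChartAt 𝓘(ℝ, E) p).symm
    (y₀ + τ ((1 - (q.1 : ℝ)) • torusIncl q.2)), ?_⟩, fun z => ?_, fun z => ?_⟩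
  · refine (continuousOn_extChartAt_symm p).comp_continuous (by fun_prop) fun q => hτ _ ?_
    rw [norm_smul, norm_torusIncl, mul_one, Real.norm_of_nonneg (by linarith [q.1.2.2])]
    linarith [q.1.2.1]
  · simp [chartTorus]
  · simp

/-- Where an almost complex structure is standard along a flat torus in a chart, it is not
tamed by any symplectic form. -/
theorem not_tames_of_chartTorus
    (hτ : ∀ z, ‖z‖ ≤ 1 → y₀ + τ z ∈ (extChartAt 𝓘(ℝ, E) p).target)
    (hinj : Function.Injective τ) {J : AlmostComplexStructure 𝓘(ℝ, E) X}
    (hJ : ∀ (z : Torus) (w : ℂ × ℂ), J.toFun (chartTorus p y₀ τ z)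
      (ofCoord p (chartTorus p y₀ τ z) (τ w)) =
        ofCoord p (chartTorus p y₀ τ z) (τ (twistedQuatJ (z.1 * z.2) w)))
    {σ : ∀ x : X, TangentSpace 𝓘(ℝ, E) x [⋀^Fin 2]→L[ℝ] ℝ} (hσ : IsSymplecticForm σ) :
    ¬ Tames σ J := by
  intro ht
  refine not_forall_torus_pos (isOpen_extChartAt_target p) (hσ.smooth p) (hσ.closed p) τ hτ
    fun z => ?_
  -- The first circle direction; `J` sends it to the second, so taming is exactly positivity on the
  -- tangent plane.
  let v := ofCoord p (chartTorus p y₀ τ z) (τ (Complex.I * z.1, 0))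
  have hv : v ≠ 0 := by
    intro h
    have h0 := injective_ofCoord (chartTorus_mem_source hτ z) (h.trans (map_zero _).symm)
    have h1 := congrArg Prod.fst (hinj (h0.trans (map_zero τ).symm))
    simp at h1
  have hJv : J.toFun _ v = ofCoord p (chartTorus p y₀ τ z) (τ (0, Complex.I * z.2)) := by
    have h := twistedQuatJ_tangent z 1 0
    simp only [Complex.ofReal_one, one_mul, Complex.ofReal_zero, zero_mul, neg_zero] at h
    rw [hJ, h]
  have := ht _ v hv
  rw [hJv] at this
  convert this using 1
  have hm := (hasMFDerivAt_extChartAt_symm (hτ _ (norm_torusIncl z).le)).mfderiv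
  change σ (chartTorus p y₀ τ z) (fun k => mfderiv 𝓘(ℝ, E) 𝓘(ℝ, E) (extChartAt 𝓘(ℝ, E) p).symm
    (y₀ + τ (torusIncl z)) (![τ (Complex.I * z.1, 0), τ (0, Complex.I * z.2)] k)) = _
  congr 1
  funext k
  fin_cases k
  · exact DFunLike.congr_fun hm (τ (Complex.I * z.1, 0))
  · exact DFunLike.congr_fun hm (τ (0, Complex.I * z.2))

end Main

end AlmostComplex

/-! ### Assembly -/

open AlmostComplex in
theorem mainTheorem9
    {E : Type*} [NormedAddCommGroup E] [NormedSpace ℝ E] [FiniteDimensional ℝ E]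
    (hdim : 4 ≤ Module.finrank ℝ E)
    {X : Type*} [TopologicalSpace X] [T2Space X] [SecondCountableTopology X]
    [ChartedSpace E X] [IsManifold 𝓘(ℝ, E) ∞ X]
    (J : AlmostComplex.AlmostComplexStructure 𝓘(ℝ, E) X)
    (U : Set X) (hU : IsOpen U) (hne : U.Nonempty) :
    ∃ J' : AlmostComplex.AlmostComplexStructure 𝓘(ℝ, E) X,
      AlmostComplex.DeformationEquivalent J J' ∧
      (∀ x ∉ U, J'.toFun x = J.toFun x) ∧
      (¬ ∃ σ : ∀ x : X, TangentSpace 𝓘(ℝ, E) x [⋀^Fin 2]→L[ℝ] ℝ,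
        AlmostComplex.IsSymplecticForm σ ∧ AlmostComplex.Tames σ J') ∧
      (∃ (j : AlmostComplex.AlmostComplexStructure ((𝓡 1).prod (𝓡 1)) AlmostComplex.Torus)
        (f : C(AlmostComplex.Torus, X)),
        Manifold.IsSmoothEmbedding ((𝓡 1).prod (𝓡 1)) 𝓘(ℝ, E) ∞ f ∧
        AlmostComplex.IsPseudoholomorphic j J' f ∧
        Set.range f ⊆ U ∧
        AlmostComplex.IsNullHomologous f) := by
  obtain ⟨p, hp⟩ := hne
  have hV₀ : IsOpen ((extChartAt 𝓘(ℝ, E) p).target ∩ (extChartAt 𝓘(ℝ, E) p).symm ⁻¹' U) :=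
    (continuousOn_extChartAt_symm p).isOpen_inter_preimage (isOpen_extChartAt_target p) hU
  obtain ⟨V, K, Θ, τ, hVo, hVV₀, hK, hKV, hΘs, hΘsq, hΘ0, hΘK, hτinj, hτV, hΘτ⟩ :=
    exists_local_deformation hdim hV₀
      (y₀ := extChartAt 𝓘(ℝ, E) p p)
      ⟨mem_extChartAt_target p, by rwa [Set.mem_preimage, extChartAt_to_inv]⟩
      ((contDiffOn_coordStructure J p).mono Set.inter_subset_left)
      (fun y hy => coordStructure_sq J p hy.1)
  have hVt : V ⊆ (extChartAt 𝓘(ℝ, E) p).target := hVV₀.trans Set.inter_subset_left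
  have hsm := contMDiff_glueFun J hVo hVt hK hKV hΘs hΘK
  let 𝒥 : ℝ → AlmostComplexStructure 𝓘(ℝ, E) X := fun t =>
    { toFun := glueFun J p V (Θ t)
      map_map := glueFun_sq J (hΘsq t)
      smooth := hsm.comp (contMDiff_const.prodMk contMDiff_id) }
  have hτ : ∀ z, ‖z‖ ≤ 1 →
      extChartAt 𝓘(ℝ, E) p p + τ z ∈ (extChartAt 𝓘(ℝ, E) p).target :=
    fun z hz => hVt (hτV z hz)
  have hJ' : ∀ (z : Torus) (w : ℂ × ℂ), (𝒥 1).toFun (chartTorus p (extChartAt 𝓘(ℝ, E) p p) τ z)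
      (ofCoord p (chartTorus p (extChartAt 𝓘(ℝ, E) p p) τ z) (τ w)) =
        ofCoord p (chartTorus p (extChartAt 𝓘(ℝ, E) p p) τ z)
          (τ (twistedQuatJ (z.1 * z.2) w)) := by
    intro z w
    have hsrc := chartTorus_mem_source hτ z
    have hchart := extChartAt_chartTorus hτ z
    have hmem : extChartAt 𝓘(ℝ, E) p (chartTorus p (extChartAt 𝓘(ℝ, E) p p) τ z) ∈ V := by
      rw [hchart]
      exact hτV _ (norm_torusIncl z).le
    change glueFun J p V (Θ 1) _ _ = _
    rw [glueFun_of_mem J (Θ 1) hsrc hmem]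
    simp only [ContinuousLinearMap.comp_apply, toCoord_ofCoord hsrc]
    rw [hchart, hΘτ _ _ (Circle.norm_coe z.1) (Circle.norm_coe z.2), twistedQuatJ_apply]
    rfl
  obtain ⟨j, hj⟩ := exists_torus_almostComplexStructure
  refine ⟨𝒥 1, ⟨𝒥, ?_, rfl, hsm.contMDiffOn⟩, ?_, ?_, j,
    ⟨chartTorus p (extChartAt 𝓘(ℝ, E) p p) τ, (contMDiff_chartTorus hτ).continuous⟩,
    isSmoothEmbedding_chartTorus hτ hτinj, ⟨contMDiff_chartTorus hτ, ?_⟩, ?_,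
    isNullHomologous_chartTorus hτ⟩
  · exact AlmostComplexStructure.ext_toFun fun x => glueFun_eq J fun _ hx => hΘ0 _ hx
  · intro x hx
    -- A point of the chart lying over `V` is in `U`, so outside `U` the field was never changed.
    refine glueFun_eq J fun hxs hxV => (hx ?_).elim
    have := (hVV₀ hxV).2
    rwa [Set.mem_preimage, (extChartAt 𝓘(ℝ, E) p).left_inv (by simpa using hxs)] at this
  · rintro ⟨σ, hσ, ht⟩
    exact not_tames_of_chartTorus hτ hτinj hJ' hσ ht
  · intro z v
    change mfderiv ((𝓡 1).prod (𝓡 1)) 𝓘(ℝ, E) (chartTorus p (extChartAt 𝓘(ℝ, E) p p) τ) z _ =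
      (𝒥 1).toFun _ (mfderiv ((𝓡 1).prod (𝓡 1)) 𝓘(ℝ, E)
        (chartTorus p (extChartAt 𝓘(ℝ, E) p p) τ) z v)
    rw [(hasMFDerivAt_chartTorus hτ z).mfderiv]
    simp only [ContinuousLinearMap.comp_apply, hj]
    exact (hJ' z _).symm
  · rintro _ ⟨z, rfl⟩
    exact (hVV₀ (hτV _ (norm_torusIncl z).le)).2
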